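/- Let $q$ be a prime power, $v, r \ge 0$ integers and $V$ a $v$-dimensional vector space over the field $\mathbb{F}_q$; $\mathrm{PG}(v-1,q)$ denotes its projective space, whose points are the $1$-dimensional linear subspaces and whose hyperplanes are the $(v-1)$-dimensional linear subspaces of $V$. A multiset $\mathcal{M}$ of points is called $q^r$-divisible if $|\mathcal{M}\cap H|\equiv|\mathcal{M}| \pmod{q^r}$ for every hyperplane $H$. An $(r+1)$-cylinder is a multiset of $q^{r+1}$ points that is the (multiset) union of the point sets of $L_1\setminus F,\dots,L_q\setminus F$, where $F$ is an $r$-dimensional linear subspace of $V$ and $L_1,\dots,L_q$ are $(r+1)$-dimensional linear subspaces containing $F$. The generalized cylinder conjecture is said to be true for $(v,r,q)$ if every $q^r$-divisible set of $q^{r+1}$ points that spans $\mathrm{PG}(v-1,q)$ is an $(r+1)$-cylinder. **Proposition.** The generalized cylinder conjecture is true for $(4,1,7)$: every $7$-divisible set of $49$ points spanning $\mathrm{PG}(3,7)$ is a $2$-cylinder. Consequently the original cylinder conjecture holds for $p=7$: every set of $49$ points in the affine space $\mathrm{AG}(3,7)$ that meets every plane in $0$ modulo $7$ points is the union of $7$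 parallel lines. -/

import Mathlib

universe u w

namespace CylinderConjecture

open Classical in
/-- A multiset `M` of points of the projective space of `V` is `Δ`-divisible if
`|M ∩ H| ≡ |M| (mod Δ)` for every hyperplane `H`, points being counted with multiplicity. -/
def IsDivisible {K : Type u} {V : Type w} [Field K] [AddCommGroup V] [Module K V]
    (Δ : ℕ) (M : Multiset (Projectivization K V)) : Prop :=
  ∀ H : Submodule K V, Module.finrank K H + 1 = Module.finrank K V →
    Multiset.card (M.filter fun P => P.submodule ≤ H) ≡ Multiset.card M [MOD Δ]

/-- The set of points of the projective space of `V` that lie in the subspace `L` but not in the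
subspace `F`. -/
noncomputable def pointsDiff {K : Type u} {V : Type w} [Field K] [AddCommGroup V] [Module K V]
    [Finite V] (L F : Submodule K V) : Finset (Projectivization K V) :=
  (Set.toFinite {P : Projectivization K V | P.submodule ≤ L ∧ ¬ P.submodule ≤ F}).toFinset

/-- A multiset `M` of points over a field with `q` elements is an `(r+1)`-cylinder if it is the
(multiset) union of the point sets of `q` affine subspaces `L₁ \ F, …, L_q \ F`, where the `Lᵢ`
are `(r+1)`-dimensional linear subspaces and `F` is an `r`-dimensional linear subspace contained
in all of them. -/
def IsCylinder {K : Type u} {V : Type w} [Field K] [AddCommGroup V] [Module K V] [Finite V]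
    (r : ℕ) (M : Multiset (Projectivization K V)) : Prop :=
  ∃ (F : Submodule K V) (L : Fin (Nat.card K) → Submodule K V),
    Module.finrank K F = r ∧
    (∀ i, Module.finrank K (L i) = r + 1 ∧ F ≤ L i) ∧
    M = ∑ i, (pointsDiff (L i) F).val

/-- The generalized cylinder conjecture for the triple `(v, r, q)`: over a field with `q` elements,
every `q ^ r`-divisible spanning set of `q ^ (r + 1)` points in the projective space of a
`v`-dimensional vector space is an `(r + 1)`-cylinder. -/
def GeneralizedCylinderConjecture (v r q : ℕ) : Prop :=
  ∀ (K : Type u) (V : Type w) [Field K] [AddCommGroup V] [Module K V] [Finite V],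
    Nat.card K = q → Module.finrank K V = v →
    ∀ S : Finset (Projectivization K V),
      S.card = q ^ (r + 1) →
      Projectivization.Subspace.span (S : Set (Projectivization K V)) = ⊤ →
      IsDivisible (q ^ r) S.val →
      IsCylinder r S.val

/-- The original cylinder conjecture for the prime `p`: a set of `p ^ 2` points of `AG(3, p)` that
meets every plane in `0` modulo `p` points is the union of `p` parallel lines. -/
def OriginalCylinderConjecture (p : ℕ) : Prop :=
  ∀ S : Set (Fin 3 → ZMod p), S.ncard = p ^ 2 →
    (∀ E : AffineSubspace (ZMod p) (Fin 3 → ZMod p),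
      Module.finrank (ZMod p) E.direction = 2 →
      (S ∩ (E : Set (Fin 3 → ZMod p))).ncard ≡ 0 [MOD p]) →
    ∃ L : Fin p → AffineSubspace (ZMod p) (Fin 3 → ZMod p),
      Function.Injective L ∧
      (∀ i, Module.finrank (ZMod p) (L i).direction = 1) ∧
      (∀ i j, (L i).Parallel (L j)) ∧
      S = ⋃ i, (L i : Set (Fin 3 → ZMod p))

end CylinderConjecture

/-!
# The cylinder conjecture over the field with seven elements

Both statements reduce to one about affine three-space
over a field `K` with seven elements: a set `S` of `49` points that meets every plane in a multiple
of `7` points is a union of seven parallel lines (`IsPlaneDivisible.exists_parallel_lines`). In the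
projective setting the average number of points on a hyperplane is below `7`, so some hyperplane is
empty and `S` is affine (`exists_empty_hyperplane`).

For a functional `u ≠ 0` let `J u c` be one seventh of the number of points of `S` with `u = c`. The
seven numbers `J u c` add up to `7`; let `r u` be the number of those that are zero, and let
`e u` be the sum of the `(J u c - 1) ^ 2`. Counting pairs of points gives `∑ e u = 252` over all
`u ≠ 0` (`IsPlaneDivisible.sum_deviation`), so there are few nontrivial directions, counted with
weights.

Two independent functionals project `S` onto a weight `n` on the affine plane whose line sums are
divisible by `7`. Modulo `7`, such a weight is a polynomial function of degree at most `5`. Hence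
either it vanishes modulo `7` everywhere, and then the fibres of the projection, which have seven
points, are full or empty and `S` is a cylinder, or there are at most five empty lines
(`sum_card_empty_le`). In the second case the line sums through a point of an empty line satisfy a
balance equation (`IsDivisibleWeight.sum_nontrivialDirections`), which leaves few possibilities: one
nontrivial direction, three with one empty line each, or four with two, one, one and one empty lines
(`IsDivisibleWeight.nontrivialDirections_cases`). The exclusion of five directions is the only place
that uses a computation in the field: the first moments of the balance equations form a system
without solutions over `ZMod 7`.

If no projection vanished modulo `7`, then the nontrivial functionals would form a set in the dual
projective plane all of whose lines are of these types. Summing `e` over the pencils through a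
nontrivial point with `r = 1`, which exists, bounds the total by less than `252`, a contradiction
(`false_of_pencil_sums`).
-/

namespace CylinderConjecture

/-! ### Weights on the affine plane with divisible line sums -/

section Planar

variable {K : Type*} [Field K]

/-- The linear forms on the affine plane up to scalars: `none` is the first coordinate, and
`some β` is `(a, b) ↦ b + β a`. A parallel class of lines is the family of level sets of one
form. -/
def form (δ : Option K) (y : K × K) : K :=
  match δ with
  | none => y.1
  | some β => y.2 + β * y.1

theorem form_none (y : K × K) : form none y = y.1 := rfl

theorem form_some (β : K) (y : K × K) : form (some β) y = y.2 + β * y.1 := rfl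

theorem form_pair_injective {δ ε : Option K} (h : δ ≠ ε) :
    Function.Injective fun y : K × K => (form δ y, form ε y) := by
  rintro ⟨a, b⟩ ⟨a', b'⟩ hy
  simp only [Prod.mk.injEq] at hy ⊢
  obtain ⟨h1, h2⟩ := hy
  rcases δ with _ | β <;> rcases ε with _ | γ <;> simp only [form_none, form_some] at h1 h2
  · exact absurd rfl h
  · subst h1; exact ⟨rfl, by simpa using h2⟩
  · subst h2; exact ⟨rfl, by simpa using h1⟩
  · have hne : β - γ ≠ 0 := sub_ne_zero.2 fun hh => h (by rw [hh])
    have ha : a = a' := by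
      apply mul_left_cancel₀ hne
      linear_combination h1 - h2
    subst ha
    exact ⟨rfl, by simpa using h1⟩

variable [Fintype K] [DecidableEq K]

omit [DecidableEq K] in
theorem form_pair_bijective {δ ε : Option K} (h : δ ≠ ε) :
    Function.Bijective fun y : K × K => (form δ y, form ε y) :=
  Finite.injective_iff_bijective.1 (form_pair_injective h)

omit [DecidableEq K] in
theorem exists_form_eq {δ ε : Option K} (h : δ ≠ ε) (c d : K) :
    ∃ y : K × K, form δ y = c ∧ form ε y = d := by
  obtain ⟨y, hy⟩ := (form_pair_bijective h).2 (c, d)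
  exact ⟨y, congrArg Prod.fst hy, congrArg Prod.snd hy⟩

theorem sum_line_form {M : Type*} [AddCommMonoid M] {δ ε : Option K} (h : δ ≠ ε) (c : K)
    (f : K → M) : ∑ y with form δ y = c, f (form ε y) = ∑ d, f d := by
  refine Finset.sum_bij (fun y _ => form ε y) (fun _ _ => Finset.mem_univ _) ?_ ?_ fun _ _ => rfl
  · intro y hy z hz hyz
    simp only [Finset.mem_filter, Finset.mem_univ, true_and] at hy hz
    exact form_pair_injective h (Prod.ext (hy.trans hz.symm) hyz)
  · intro d _
    obtain ⟨y, h1, h2⟩ := exists_form_eq h c d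
    exact ⟨y, by simpa using h1, h2⟩

theorem card_form_eq (hK : Fintype.card K = 7) (y z : K × K) :
    (Finset.univ.filter fun δ : Option K => form δ z = form δ y).card = if z = y then 8 else 1 := by
  split_ifs with h
  · subst h
    simp [hK]
  · rw [Finset.card_eq_one]
    obtain ⟨a, b⟩ := y
    obtain ⟨a', b'⟩ := z
    have key : ∃ δ, form δ (a', b') = form δ (a, b) := by
      by_cases ha : a' = a
      · exact ⟨none, ha⟩
      · refine ⟨some (-(b' - b) / (a' - a)), ?_⟩
        have : a' - a ≠ 0 := sub_ne_zero.2 ha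
        simp only [form_some]
        field_simp
        ring
    obtain ⟨δ, hδ⟩ := key
    refine ⟨δ, ?_⟩
    ext ε
    simp only [Finset.mem_filter, Finset.mem_univ, true_and, Finset.mem_singleton]
    constructor
    · intro hε
      by_contra hne
      exact h (form_pair_injective hne (Prod.ext hε hδ))
    · rintro rfl
      exact hδ

/-- `n` is a weight function of total weight `49` on the affine plane, and the line `form δ = c`
has weight `7 * J δ c`; so `J δ` distributes seven objects over the lines of the parallel class
`δ`. -/
structure IsDivisibleWeight (n : K × K → ℕ) (J : Option K → K → ℕ) : Prop where
  sum_line : ∀ δ c, ∑ y with form δ y = c, n y = 7 * J δ c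
  sum_univ : ∑ y, n y = 49

namespace IsDivisibleWeight

variable {n : K × K → ℕ} {J : Option K → K → ℕ}

theorem sum_J (h : IsDivisibleWeight n J) (δ : Option K) : ∑ c, J δ c = 7 := by
  have h1 : ∑ c, 7 * J δ c = 49 := by
    rw [← h.sum_univ, ← Finset.sum_fiberwise (s := Finset.univ) (g := form δ)]
    exact Finset.sum_congr rfl fun c _ => (h.sum_line δ c).symm
  rw [← Finset.mul_sum] at h1
  omega

/-- The line sums through a point determine the weight of the point, since every other point lies
on exactly one line through it. -/
theorem sum_J_form (hK : Fintype.card K = 7) (h : IsDivisibleWeight n J) (y : K × K) :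
    ∑ δ, J δ (form δ y) = 7 + n y := by
  have h1 : ∑ δ, 7 * J δ (form δ y) = 49 + 7 * n y := by
    calc ∑ δ, 7 * J δ (form δ y) = ∑ δ, ∑ z, if form δ z = form δ y then n z else 0 := by
          refine Finset.sum_congr rfl fun δ _ => ?_
          rw [← h.sum_line, Finset.sum_filter]
      _ = ∑ z, n z * (if z = y then 8 else 1) := by
          rw [Finset.sum_comm]
          refine Finset.sum_congr rfl fun z _ => ?_
          rw [← card_form_eq hK, ← Finset.sum_filter, Finset.sum_const, smul_eq_mul, mul_comm]
      _ = ∑ z, (n z + if z = y then 7 * n z else 0) := by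
          refine Finset.sum_congr rfl fun z _ => ?_
          split_ifs <;> ring
      _ = 49 + 7 * n y := by
          rw [Finset.sum_add_distrib, h.sum_univ]
          simp
  rw [← Finset.mul_sum] at h1
  omega

theorem eq_zero_of_J_eq_zero (h : IsDivisibleWeight n J) {δ : Option K} {y : K × K}
    (hJ : J δ (form δ y) = 0) : n y = 0 := by
  have h1 := h.sum_line δ (form δ y)
  rw [hJ, mul_zero, Finset.sum_eq_zero_iff] at h1
  exact h1 y (by simp)

end IsDivisibleWeight

/-! ### The degree bound for planar weights -/

omit [DecidableEq K] in
theorem cast_seven (hK : Fintype.card K = 7) : (7 : K) = 0 := by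
  have := Nat.cast_card_eq_zero K
  rw [hK] at this
  exact_mod_cast this

open Polynomial in
/-- The moments of order at most `6` vanish: for every `β` the sum of `n y * (y.2 + β * y.1) ^ k`
is a combination of line sums, hence zero, and it is a polynomial in `β` of degree below `7`. -/
theorem moment_eq_zero (hK : Fintype.card K = 7) {n : K × K → ℕ} {J : Option K → K → ℕ}
    (h : IsDivisibleWeight n J) {i j : ℕ} (hij : i + j ≤ 6) :
    ∑ y, (n y : K) * (y.1 ^ i * y.2 ^ j) = 0 := by
  have h7 := cast_seven hK
  set k := i + j with hk
  let p : K[X] := ∑ l ∈ Finset.range (k + 1),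
    C ((k.choose l : K) * ∑ y, (n y : K) * (y.1 ^ l * y.2 ^ (k - l))) * X ^ l
  have hp : p = 0 := by
    refine Polynomial.eq_zero_of_natDegree_lt_card_of_eval_eq_zero p Function.injective_id
      (fun β => ?_) (lt_of_le_of_lt (b := k) ?_ (by omega))
    · have h1 : p.eval β = ∑ y, (n y : K) * (form (some β) y) ^ k := by
        simp only [p, eval_finsetSum, eval_mul, eval_C, eval_pow, eval_X, form_some, Finset.mul_sum,
          Finset.sum_mul]
        rw [Finset.sum_comm]
        refine Finset.sum_congr rfl fun y _ => ?_
        rw [add_comm (y.2), add_pow, Finset.mul_sum]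
        refine Finset.sum_congr rfl fun l _ => ?_
        rw [mul_pow]
        ring
      rw [id, h1, ← Finset.sum_fiberwise (s := Finset.univ) (g := form (some β))]
      refine Finset.sum_eq_zero fun c _ => ?_
      have h2 : ∑ y with form (some β) y = c, (n y : K) * form (some β) y ^ k
          = (∑ y with form (some β) y = c, (n y : K)) * c ^ k := by
        rw [Finset.sum_mul]
        refine Finset.sum_congr rfl fun y hy => ?_
        rw [(Finset.mem_filter.1 hy).2]
      rw [h2, ← Nat.cast_sum, h.sum_line]
      push_cast
      rw [h7]
      ring
    · refine natDegree_sum_le_of_forall_le _ _ fun l hl => ?_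
      exact (natDegree_C_mul_X_pow_le _ _).trans (by simpa [Nat.lt_succ_iff] using hl)
  have hc : p.coeff i = (k.choose i : K) * ∑ y, (n y : K) * (y.1 ^ i * y.2 ^ (k - i)) := by
    simp only [p, finsetSum_coeff, coeff_C_mul, coeff_X_pow]
    rw [Finset.sum_eq_single i]
    · simp
    · intro b _ hb
      simp [Ne.symm hb]
    · intro hi
      exact absurd (Finset.mem_range.2 (by omega)) hi
  rw [hp, coeff_zero, hk, Nat.add_sub_cancel_left] at hc
  refine (mul_eq_zero.1 hc.symm).resolve_left ?_
  rw [← hk]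
  have : Fact (Nat.Prime 7) := ⟨by norm_num⟩
  have : CharP K 7 := charP_of_card_eq_prime hK
  intro hd
  rw [CharP.cast_eq_zero_iff K 7] at hd
  have h3 : 7 ∣ k.factorial :=
    hd.trans ⟨_, by rw [← mul_assoc, Nat.choose_mul_factorial_mul_factorial (show i ≤ k by omega)]⟩
  have := (Nat.Prime.dvd_factorial (by norm_num)).1 h3
  omega

open Polynomial in
/-- Interpolation: modulo `7`, the weight is a polynomial function whose coefficients are moments.
By `moment_eq_zero` only the monomials of total degree at most `5` survive. -/
theorem cast_eq_sum (hK : Fintype.card K = 7) {n : K × K → ℕ} {J : Option K → K → ℕ}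
    (h : IsDivisibleWeight n J) (y : K × K) :
    (n y : K) = ∑ j ∈ Finset.range 7, ∑ i ∈ Finset.range 7,
      (∑ z, (n z : K) * (z.1 ^ (6 - i) * z.2 ^ (6 - j))) * (y.1 ^ i * y.2 ^ j) := by
  have h7 := cast_seven hK
  -- the indicator function of a point of the affine line
  have ind : ∀ s t : K, (if s = t then 1 else 0)
      = 1 - ∑ i ∈ Finset.range 7, t ^ i * s ^ (6 - i) := by
    intro s t
    have h1 : ∑ i ∈ Finset.range 7, t ^ i * s ^ (6 - i) = (t - s) ^ 6 := by
      simp only [Finset.sum_range_succ, Finset.sum_range_zero]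
      norm_num
      linear_combination (t ^ 5 * s - 2 * t ^ 4 * s ^ 2 + 3 * t ^ 3 * s ^ 3 - 2 * t ^ 2 * s ^ 4
        + t * s ^ 5) * h7
    rw [h1]
    split_ifs with hst
    · simp [hst]
    · have := FiniteField.pow_card_sub_one_eq_one (t - s) (sub_ne_zero.2 (Ne.symm hst))
      rw [hK] at this
      rw [this, sub_self]
  have h1 : (n y : K) = ∑ z, (n z : K) * ((if z.1 = y.1 then 1 else 0)
      * (if z.2 = y.2 then 1 else 0)) := by
    rw [Finset.sum_eq_single y]
    · simp
    · intro z _ hz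
      by_cases h1 : z.1 = y.1
      · have h2 : z.2 ≠ y.2 := fun h2 => hz (Prod.ext h1 h2)
        simp [h2]
      · simp [h1]
    · simp
  have hm := fun i j hij => moment_eq_zero hK h (i := i) (j := j) hij
  have e1 : ∑ z, (n z : K) = 0 := by simpa using hm 0 0 (by norm_num)
  have e2 : ∑ z, (n z : K) * ∑ i ∈ Finset.range 7, y.1 ^ i * z.1 ^ (6 - i) = 0 := by
    simp only [Finset.mul_sum]
    rw [Finset.sum_comm]
    refine Finset.sum_eq_zero fun i _ => ?_
    have := hm (6 - i) 0 (by omega)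
    simp only [pow_zero, mul_one] at this
    rw [← mul_zero (y.1 ^ i), ← this, Finset.mul_sum]
    exact Finset.sum_congr rfl fun z _ => by ring
  have e3 : ∑ z, (n z : K) * ∑ i ∈ Finset.range 7, y.2 ^ i * z.2 ^ (6 - i) = 0 := by
    simp only [Finset.mul_sum]
    rw [Finset.sum_comm]
    refine Finset.sum_eq_zero fun i _ => ?_
    have := hm 0 (6 - i) (by omega)
    simp only [pow_zero, one_mul] at this
    rw [← mul_zero (y.2 ^ i), ← this, Finset.mul_sum]
    exact Finset.sum_congr rfl fun z _ => by ring
  have e4 : ∑ z, (n z : K) * ((∑ i ∈ Finset.range 7, y.1 ^ i * z.1 ^ (6 - i))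
      * ∑ j ∈ Finset.range 7, y.2 ^ j * z.2 ^ (6 - j))
      = ∑ j ∈ Finset.range 7, ∑ i ∈ Finset.range 7,
      (∑ z, (n z : K) * (z.1 ^ (6 - i) * z.2 ^ (6 - j))) * (y.1 ^ i * y.2 ^ j) := by
    simp only [Finset.mul_sum, Finset.sum_mul]
    rw [Finset.sum_comm]
    refine Finset.sum_congr rfl fun j _ => ?_
    rw [Finset.sum_comm]
    exact Finset.sum_congr rfl fun i _ => Finset.sum_congr rfl fun z _ => by ring
  rw [h1, ← e4]
  simp only [ind]
  have e5 : ∀ z : K × K, (n z : K) * ((1 - ∑ i ∈ Finset.range 7, y.1 ^ i * z.1 ^ (6 - i)) *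
      (1 - ∑ i ∈ Finset.range 7, y.2 ^ i * z.2 ^ (6 - i)))
      = (n z : K) - (n z : K) * (∑ i ∈ Finset.range 7, y.1 ^ i * z.1 ^ (6 - i))
        - (n z : K) * (∑ i ∈ Finset.range 7, y.2 ^ i * z.2 ^ (6 - i))
        + (n z : K) * ((∑ i ∈ Finset.range 7, y.1 ^ i * z.1 ^ (6 - i))
          * ∑ j ∈ Finset.range 7, y.2 ^ j * z.2 ^ (6 - j)) := fun z => by ring
  simp only [e5, Finset.sum_add_distrib, Finset.sum_sub_distrib, e1, e2, e3]
  ring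

open Polynomial in
/-- A weight that is not divisible by `7` everywhere has at most five empty lines, because a
nonzero polynomial of total degree at most `5` vanishes on at most five lines. The polynomial is
viewed as a polynomial in `Y` over `K[X]`: an empty line `Y = c - β X` is a root, and each empty
vertical line lowers the bound on the degree in `Y` by one. -/
theorem sum_card_empty_le (hK : Fintype.card K = 7) {n : K × K → ℕ} {J : Option K → K → ℕ}
    (h : IsDivisibleWeight n J) (hn : ∃ y, (n y : K) ≠ 0) :
    ∑ δ, (Finset.univ.filter fun c => J δ c = 0).card ≤ 5 := by
  by_contra! hcon
  let m : ℕ → ℕ → K := fun i j => ∑ z, (n z : K) * (z.1 ^ (6 - i) * z.2 ^ (6 - j))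
  have hm : ∀ i ∈ Finset.range 7, ∀ j ∈ Finset.range 7, 6 ≤ i + j → m i j = 0 := by
    intro i hi j hj hij
    rw [Finset.mem_range] at hi hj
    exact moment_eq_zero hK h (by omega)
  let Q : ℕ → K[X] := fun j => ∑ i ∈ Finset.range 7, C (m i j) * X ^ i
  let P : K[X][X] := ∑ j ∈ Finset.range 7, C (Q j) * X ^ j
  have hQdeg : ∀ j ∈ Finset.range 7, (Q j).natDegree ≤ 5 - j := by
    intro j hj
    refine natDegree_sum_le_of_forall_le _ _ fun i hi => ?_
    by_cases hij : 6 ≤ i + j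
    · simp [hm i hi j hj hij]
    · exact (natDegree_C_mul_X_pow_le _ _).trans (by omega)
  have hQeval : ∀ y : K × K, (n y : K) = ∑ j ∈ Finset.range 7, (Q j).eval y.1 * y.2 ^ j := by
    intro y
    rw [cast_eq_sum hK h]
    refine Finset.sum_congr rfl fun j _ => ?_
    simp only [Q, eval_finsetSum, eval_mul, eval_C, eval_pow, eval_X]
    rw [Finset.sum_mul]
    exact Finset.sum_congr rfl fun i _ => (mul_assoc _ _ _).symm
  set Z : Option K → Finset K := fun δ => Finset.univ.filter fun c => J δ c = 0 with hZ
  -- an empty vertical line is a common zero of all the coefficients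
  have hQzero : ∀ j ∈ Finset.range 7, ∀ c ∈ Z none, (Q j).eval c = 0 := by
    intro j hj c hc
    let p : K[X] := ∑ l ∈ Finset.range 7, C ((Q l).eval c) * X ^ l
    have hp : p = 0 := by
      refine Polynomial.eq_zero_of_natDegree_lt_card_of_eval_eq_zero p Function.injective_id
        (fun b => ?_) (lt_of_le_of_lt (b := 6) ?_ (by omega))
      · simp only [p, eval_finsetSum, eval_mul, eval_C, eval_pow, eval_X, id]
        rw [← hQeval (c, b), h.eq_zero_of_J_eq_zero (δ := none) (y := (c, b)), Nat.cast_zero]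
        simpa [hZ, form_none] using hc
      · refine natDegree_sum_le_of_forall_le _ _ fun l hl => ?_
        rw [Finset.mem_range] at hl
        exact (natDegree_C_mul_X_pow_le _ _).trans (by omega)
    have hc : p.coeff j = (Q j).eval c := by
      simp only [p, finsetSum_coeff, coeff_C_mul, coeff_X_pow]
      rw [Finset.sum_eq_single j]
      · simp
      · intro b _ hb
        simp [Ne.symm hb]
      · exact fun hi => absurd hj hi
    rw [← hc, hp, coeff_zero]
  have hQ0 : ∀ j ∈ Finset.range 7, 6 ≤ j + (Z none).card → Q j = 0 := by
    intro j hj hjr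
    by_cases h0 : (Z none).card = 0
    · simp only [Q]
      refine Finset.sum_eq_zero fun i hi => ?_
      rw [hm i hi j hj (by omega), C_0, zero_mul]
    · refine Polynomial.eq_zero_of_natDegree_lt_card_of_eval_eq_zero' (Q j) (Z none)
        (hQzero j hj) ?_
      have := hQdeg j hj
      omega
  have hP : P ≠ 0 := by
    rintro hP
    obtain ⟨y, hy⟩ := hn
    apply hy
    rw [hQeval]
    have : (P.eval (C y.2)).eval y.1 = ∑ j ∈ Finset.range 7, (Q j).eval y.1 * y.2 ^ j := by
      simp [P, eval_finsetSum]
    rw [← this, hP]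
    simp
  have hr5 : (Z none).card ≤ 5 := by
    by_contra! hr
    exact hP (Finset.sum_eq_zero fun j hj => by rw [hQ0 j hj (by omega), C_0, zero_mul])
  have hPdeg : P.natDegree ≤ 5 - (Z none).card := by
    refine natDegree_sum_le_of_forall_le _ _ fun j hj => ?_
    by_cases hjr : 6 ≤ j + (Z none).card
    · simp [hQ0 j hj hjr]
    · exact (natDegree_C_mul_X_pow_le _ _).trans (by omega)
  -- each non-vertical empty line is a root
  let R : Finset K[X] := (Finset.univ.sigma fun β : K => Z (some β)).image
    fun x => C x.2 - C x.1 * X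
  have hR : R.card = ∑ β : K, (Z (some β)).card := by
    rw [Finset.card_image_of_injective, Finset.card_sigma]
    rintro ⟨β, c⟩ ⟨β', c'⟩ hx
    have h0 := congrArg (fun p => p.coeff 0) hx
    have h1 := congrArg (fun p => p.coeff 1) hx
    simp at h0 h1
    rw [h0, h1]
  apply hP
  refine Polynomial.eq_zero_of_natDegree_lt_card_of_eval_eq_zero' P R ?_ ?_
  · intro q hq
    simp only [R, Finset.mem_image, Finset.mem_sigma, Finset.mem_univ, true_and] at hq
    obtain ⟨⟨β, c⟩, hc, rfl⟩ := hq
    dsimp only at hc ⊢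
    refine Polynomial.eq_zero_of_natDegree_lt_card_of_eval_eq_zero _ Function.injective_id
        (fun a => ?_) (lt_of_le_of_lt (b := 5) ?_ (by omega))
    · have h1 : (P.eval (C c - C β * X)).eval a
          = ∑ j ∈ Finset.range 7, (Q j).eval a * (c - β * a) ^ j := by
        simp [P, eval_finsetSum]
      rw [id, h1, ← hQeval (a, c - β * a),
        h.eq_zero_of_J_eq_zero (δ := some β) (y := (a, c - β * a)), Nat.cast_zero]
      simpa [hZ, form_some] using hc
    · simp only [P, eval_finsetSum, eval_mul, eval_C, eval_pow, eval_X]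
      refine natDegree_sum_le_of_forall_le _ _ fun j hj => ?_
      by_cases hj5 : j ≤ 5
      · refine natDegree_mul_le.trans ?_
        have h2 : (C c - C β * X : K[X]).natDegree ≤ 1 := by compute_degree
        have h3 := natDegree_pow_le_of_le j h2
        have := hQdeg j hj
        omega
      · simp [hQ0 j hj (by omega)]
  · rw [hR]
    rw [Fintype.sum_option] at hcon
    change 5 < (Z none).card + ∑ β : K, (Z (some β)).card at hcon
    omega

end Planar

/-! ### Distributions of seven objects over the lines of a parallel class -/

section Distribution

variable {K : Type*} [Fintype K]

/-- The number of lines of a parallel class that carry no weight. -/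
def emptyCount (J : K → ℕ) : ℕ := (Finset.univ.filter fun c => J c = 0).card

/-- The squared distance of a distribution from the constant distribution `1`. -/
def deviation (J : K → ℕ) : ℤ := ∑ c, ((J c : ℤ) - 1) ^ 2

theorem sum_sub_one_eq_zero (hK : Fintype.card K = 7) {J : K → ℕ} (hJ : ∑ c, J c = 7) :
    ∑ c, ((J c : ℤ) - 1) = 0 := by
  rw [Finset.sum_sub_distrib, ← Nat.cast_sum, hJ]
  simp [hK]

theorem emptyCount_eq_sum (J : K → ℕ) :
    (emptyCount J : ℤ) = ∑ c, if J c = 0 then 1 else 0 := by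
  rw [emptyCount, Finset.card_filter]
  push_cast
  rfl

/-- The truncated differences `J c - 1` measure the surplus of the heavy lines; their sum is the
number of empty lines. -/
theorem sum_pred (hK : Fintype.card K = 7) {J : K → ℕ} (hJ : ∑ c, J c = 7) :
    ∑ c, (J c - 1) = emptyCount J := by
  have h1 : (∑ c, ((J c - 1 : ℕ) : ℤ)) = emptyCount J := by
    rw [emptyCount_eq_sum, ← sub_eq_zero, ← Finset.sum_sub_distrib]
    refine Eq.trans (Finset.sum_congr rfl fun c _ => ?_) (sum_sub_one_eq_zero hK hJ)
    split_ifs <;> omega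
  exact_mod_cast h1

theorem sum_abs_sub_one (hK : Fintype.card K = 7) {J : K → ℕ} (hJ : ∑ c, J c = 7) :
    ∑ c, |(J c : ℤ) - 1| = 2 * emptyCount J := by
  have h1 : ∑ c, |(J c : ℤ) - 1| = ∑ c, (((J c : ℤ) - 1) + 2 * if J c = 0 then 1 else 0) := by
    refine Finset.sum_congr rfl fun c _ => ?_
    split_ifs with h
    · simp [h]
    · rw [abs_of_nonneg] <;> omega
  rw [h1, Finset.sum_add_distrib, sum_sub_one_eq_zero hK hJ, ← Finset.mul_sum,
    ← emptyCount_eq_sum, zero_add]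

theorem deviation_le (hK : Fintype.card K = 7) {J : K → ℕ} (hJ : ∑ c, J c = 7) :
    deviation J ≤ emptyCount J + (emptyCount J : ℤ) ^ 2 := by
  have h1 : deviation J = emptyCount J + ∑ c, ((J c - 1 : ℕ) : ℤ) * ((J c - 1 : ℕ) : ℤ) := by
    rw [deviation, emptyCount_eq_sum, ← Finset.sum_add_distrib]
    refine Finset.sum_congr rfl fun c _ => ?_
    split_ifs with h
    · simp [h]
    · rw [Nat.cast_sub (by omega)]
      push_cast
      ring
  have h2 : ∑ c, ((J c - 1 : ℕ) : ℤ) = emptyCount J := by exact_mod_cast sum_pred hK hJ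
  rw [h1]
  have h3 : ∑ c, ((J c - 1 : ℕ) : ℤ) * ((J c - 1 : ℕ) : ℤ)
      ≤ ∑ c, (emptyCount J : ℤ) * ((J c - 1 : ℕ) : ℤ) := by
    refine Finset.sum_le_sum fun c _ => mul_le_mul_of_nonneg_right ?_ (by positivity)
    rw [← h2]
    exact Finset.single_le_sum (f := fun c => ((J c - 1 : ℕ) : ℤ)) (fun _ _ => by positivity)
      (Finset.mem_univ c)
  rw [← Finset.mul_sum, h2] at h3
  linarith [sq (emptyCount J : ℤ)]

theorem eq_one_of_emptyCount_eq_zero (hK : Fintype.card K = 7) {J : K → ℕ} (hJ : ∑ c, J c = 7)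
    (h : emptyCount J = 0) (c : K) : J c = 1 := by
  have h1 := sum_pred hK hJ
  rw [h, Finset.sum_eq_zero_iff] at h1
  have h2 := h1 c (Finset.mem_univ c)
  rw [emptyCount, Finset.card_eq_zero, Finset.filter_eq_empty_iff] at h
  have h3 : J c ≠ 0 := h (Finset.mem_univ c)
  omega

theorem exists_eq_zero_of_emptyCount_ne_zero {J : K → ℕ} (h : emptyCount J ≠ 0) :
    ∃ c, J c = 0 := by
  obtain ⟨c, hc⟩ := Finset.card_ne_zero.1 h
  exact ⟨c, (Finset.mem_filter.1 hc).2⟩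

/-- A distribution with a single empty line `a` has a single heavy line `b`, of weight two. -/
theorem exists_of_emptyCount_eq_one [DecidableEq K] (hK : Fintype.card K = 7) {J : K → ℕ}
    (hJ : ∑ c, J c = 7) (h : emptyCount J = 1) :
    ∃ a b, a ≠ b ∧ ∀ c, (J c : ℤ) - 1 = (if c = b then 1 else 0) - if c = a then 1 else 0 := by
  obtain ⟨a, ha⟩ := Finset.card_eq_one.1 h
  have ha' : ∀ c, J c = 0 ↔ c = a := fun c => by
    simpa using Finset.ext_iff.1 ha c
  have h1 := sum_pred hK hJ
  rw [h] at h1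
  obtain ⟨b, -, hb⟩ : ∃ b ∈ Finset.univ, J b - 1 ≠ 0 :=
    Finset.exists_ne_zero_of_sum_ne_zero (by rw [h1]; exact one_ne_zero)
  have h2 := Finset.add_sum_erase Finset.univ (fun c => J c - 1) (Finset.mem_univ b)
  rw [h1] at h2
  have h3 : ∑ c ∈ Finset.univ.erase b, (J c - 1) = 0 := by omega
  rw [Finset.sum_eq_zero_iff] at h3
  have hJa := (ha' a).2 rfl
  have hab : a ≠ b := by
    rintro rfl
    omega
  refine ⟨a, b, hab, fun c => ?_⟩
  by_cases hcb : c = b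
  · subst hcb
    rw [if_pos rfl, if_neg (Ne.symm hab)]
    omega
  · rw [if_neg hcb]
    have h4 := h3 c (Finset.mem_erase.2 ⟨hcb, Finset.mem_univ c⟩)
    by_cases hca : c = a
    · subst hca
      rw [if_pos rfl, hJa]
      rfl
    · rw [if_neg hca]
      have := mt (ha' c).1 hca
      omega

end Distribution

/-! ### Nontrivial directions of a planar weight -/

section Planar

variable {K : Type*} [Field K] [Fintype K] [DecidableEq K]

/-- The parallel classes that contain an empty line. -/
def nontrivialDirections (J : Option K → K → ℕ) : Finset (Option K) :=
  Finset.univ.filter fun δ => emptyCount (J δ) ≠ 0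

omit [Field K] [DecidableEq K] in
theorem mem_nontrivialDirections {J : Option K → K → ℕ} {δ : Option K} :
    δ ∈ nontrivialDirections J ↔ emptyCount (J δ) ≠ 0 := by
  simp [nontrivialDirections]

namespace IsDivisibleWeight

variable {n : K × K → ℕ} {J : Option K → K → ℕ}

/-- The basic balance: at a point of an empty line the deviations of all line sums add up to `-1`,
so those of the other lines through the point cancel. -/
theorem sum_nontrivialDirections (hK : Fintype.card K = 7) (h : IsDivisibleWeight n J)
    {δ : Option K} {y : K × K} (hJ : J δ (form δ y) = 0) :
    ∑ ε ∈ nontrivialDirections J, ((J ε (form ε y) : ℤ) - 1) = -1 := by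
  have h1 : ∑ ε ∈ nontrivialDirections J, ((J ε (form ε y) : ℤ) - 1)
      = ∑ ε, ((J ε (form ε y) : ℤ) - 1) := by
    refine Finset.sum_subset (Finset.subset_univ _) fun ε _ hε => ?_
    rw [mem_nontrivialDirections, not_not] at hε
    rw [eq_one_of_emptyCount_eq_zero hK (h.sum_J ε) hε]
    rfl
  rw [h1, Finset.sum_sub_distrib, ← Nat.cast_sum, h.sum_J_form hK, h.eq_zero_of_J_eq_zero hJ]
  simp [hK]

/-- With two nontrivial directions, two empty lines would meet in a point without compensation. -/
theorem card_nontrivialDirections_ne_two (hK : Fintype.card K = 7) (h : IsDivisibleWeight n J) :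
    (nontrivialDirections J).card ≠ 2 := by
  intro h2
  obtain ⟨δ, ε, hne, hD⟩ := Finset.card_eq_two.1 h2
  have hδ : δ ∈ nontrivialDirections J := by simp [hD]
  have hε : ε ∈ nontrivialDirections J := by simp [hD]
  obtain ⟨c, hc⟩ := exists_eq_zero_of_emptyCount_ne_zero (mem_nontrivialDirections.1 hδ)
  obtain ⟨d, hd⟩ := exists_eq_zero_of_emptyCount_ne_zero (mem_nontrivialDirections.1 hε)
  obtain ⟨y, rfl, rfl⟩ := exists_form_eq hne c d
  have := h.sum_nontrivialDirections hK hc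
  rw [hD, Finset.sum_pair hne, hc, hd] at this
  norm_num at this

/-- On an empty line of direction `i` the deviations of directions `j` and `k` are opposite. -/
theorem emptyCount_eq_of_eq_triple (hK : Fintype.card K = 7) (h : IsDivisibleWeight n J)
    {i j k : Option K} (hij : i ≠ j) (hik : i ≠ k) (hjk : j ≠ k)
    (hD : nontrivialDirections J = {i, j, k}) : emptyCount (J j) = emptyCount (J k) := by
  have hi : i ∈ nontrivialDirections J := by simp [hD]
  obtain ⟨c, hc⟩ := exists_eq_zero_of_emptyCount_ne_zero (mem_nontrivialDirections.1 hi)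
  have h1 := sum_line_form hij c fun d => |(J j d : ℤ) - 1|
  have h2 := sum_line_form hik c fun d => |(J k d : ℤ) - 1|
  rw [sum_abs_sub_one hK (h.sum_J _)] at h1 h2
  have h3 : ∑ y with form i y = c, |(J j (form j y) : ℤ) - 1|
      = ∑ y with form i y = c, |(J k (form k y) : ℤ) - 1| := by
    refine Finset.sum_congr rfl fun y hy => ?_
    have hy' : form i y = c := (Finset.mem_filter.1 hy).2
    subst hy'
    have h4 := h.sum_nontrivialDirections hK hc
    rw [hD, Finset.sum_insert (by simp [hij, hik]), Finset.sum_pair hjk, hc] at h4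
    rw [show (J j (form j y) : ℤ) - 1 = -((J k (form k y) : ℤ) - 1) by push_cast at h4; linarith,
      abs_neg]
  omega

theorem emptyCount_eq_one_of_card_eq_three (hK : Fintype.card K = 7) (h : IsDivisibleWeight n J)
    (hn : ∃ y, (n y : K) ≠ 0) (h3 : (nontrivialDirections J).card = 3) :
    ∀ δ ∈ nontrivialDirections J, emptyCount (J δ) = 1 := by
  obtain ⟨i, j, k, hij, hik, hjk, hD⟩ := Finset.card_eq_three.1 h3
  have h1 := h.emptyCount_eq_of_eq_triple hK hij hik hjk hD
  have h2 := h.emptyCount_eq_of_eq_triple hK (i := k) (j := i) (k := j) hik.symm hjk.symm hij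
    (by rw [hD]; ext; simp; tauto)
  have h5 : ∑ δ ∈ nontrivialDirections J, emptyCount (J δ) ≤ 5 :=
    (Finset.sum_le_sum_of_subset (Finset.subset_univ _)).trans (sum_card_empty_le hK h hn)
  rw [hD, Finset.sum_insert (by simp [hij, hik]), Finset.sum_pair hjk] at h5
  have hi := mem_nontrivialDirections.1 (show i ∈ nontrivialDirections J by simp [hD])
  intro δ hδ
  rw [hD] at hδ
  simp only [Finset.mem_insert, Finset.mem_singleton] at hδ
  rcases hδ with rfl | rfl | rfl <;> omega

/-- Four directions cannot all have a single empty line: the six intersection points of the four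
empty lines have to be distinct and each has to lie on one of the four heavy lines, but a heavy
line contains at most one of them. -/
theorem not_four_simple (hK : Fintype.card K = 7) (h : IsDivisibleWeight n J)
    (h4 : (nontrivialDirections J).card = 4) :
    ∃ δ ∈ nontrivialDirections J, emptyCount (J δ) ≠ 1 := by
  by_contra! hone
  obtain ⟨i, j, k, l, hij, hik, hil, hjk, hjl, hkl, hD⟩ := Finset.card_eq_four.1 h4
  choose! a b hab hJ using fun δ hδ => exists_of_emptyCount_eq_one hK (h.sum_J δ) (hone δ hδ)
  have hsum : ∀ x ∈ nontrivialDirections J, ∀ y : K × K, form x y = a x →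
      ∑ ε ∈ nontrivialDirections J, ((if form ε y = b ε then (1 : ℤ) else 0)
        - if form ε y = a ε then 1 else 0) = -1 := by
    intro x hx y hy
    have hx0 : J x (form x y) = 0 := by
      have := hJ x hx (form x y)
      rw [if_neg (by rw [hy]; exact hab x hx), if_pos hy] at this
      omega
    rw [← h.sum_nontrivialDirections hK hx0]
    exact Finset.sum_congr rfl fun ε hε => (hJ ε hε _).symm
  -- two of the four empty lines meet in a point of one of the heavy lines of the two
  -- other directions, and off the two other empty lines
  have key : ∀ p q r s, p ≠ q → p ≠ r → p ≠ s → q ≠ r → q ≠ s → r ≠ s →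
      nontrivialDirections J = {p, q, r, s} → ∀ y : K × K, form p y = a p → form q y = a q →
      (form r y = b r ∨ form s y = b s) ∧ form r y ≠ a r ∧ form s y ≠ a s := by
    intro p q r s hpq hpr hps hqr hqs hrs hD y hp hq
    have hmem : ∀ x, x = p ∨ x = q ∨ x = r ∨ x = s → x ∈ nontrivialDirections J := by
      intro x hx
      rw [hD]
      simpa using hx
    have h1 := hsum p (hmem p (by simp)) y hp
    have ap := hab p (hmem p (by simp))
    have aq := hab q (hmem q (by simp))
    have ar := hab r (hmem r (by simp))
    have as := hab s (hmem s (by simp))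
    rw [hD, Finset.sum_insert (by simp [hpq, hpr, hps]), Finset.sum_insert (by simp [hqr, hqs]),
      Finset.sum_pair hrs, hp, hq, if_neg ap, if_neg aq, if_pos rfl, if_pos rfl] at h1
    refine ⟨?_, ?_, ?_⟩
    · by_contra! hcon
      rw [if_neg hcon.1, if_neg hcon.2] at h1
      split_ifs at h1 <;> omega
    · intro hr
      rw [hr, if_neg ar, if_pos rfl] at h1
      split_ifs at h1 <;> omega
    · intro hs
      rw [hs, if_neg as, if_pos rfl] at h1
      split_ifs at h1 <;> omega
  -- a heavy line contains at most one of these points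
  have conf : ∀ p q r s, p ≠ q → p ≠ r → p ≠ s → q ≠ r → q ≠ s → r ≠ s →
      nontrivialDirections J = {p, q, r, s} → ∀ y z : K × K, form p y = a p → form q y = a q →
      form p z = a p → form r z = a r → form s y = b s → form s z = b s → False := by
    intro p q r s hpq hpr hps hqr hqs hrs hD y z hpy hqy hpz hrz hsy hsz
    have hyz : y = z := form_pair_injective hps (Prod.ext (hpy.trans hpz.symm) (hsy.trans hsz.symm))
    subst hyz
    exact (key p q r s hpq hpr hps hqr hqs hrs hD y hpy hqy).2.1 hrz
  obtain ⟨yij, ij1, ij2⟩ := exists_form_eq hij (a i) (a j)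
  obtain ⟨yik, ik1, ik2⟩ := exists_form_eq hik (a i) (a k)
  obtain ⟨yil, il1, il2⟩ := exists_form_eq hil (a i) (a l)
  obtain ⟨yjk, jk1, jk2⟩ := exists_form_eq hjk (a j) (a k)
  obtain ⟨yjl, jl1, jl2⟩ := exists_form_eq hjl (a j) (a l)
  have perm : ∀ p q r s : Option K, (∀ x, (x = i ∨ x = j ∨ x = k ∨ x = l) =
      (x = p ∨ x = q ∨ x = r ∨ x = s)) → nontrivialDirections J = {p, q, r, s} := by
    intro p q r s hx
    rw [hD]
    ext x
    simpa using iff_of_eq (hx x)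
  have c1 := (key i j k l hij hik hil hjk hjl hkl hD yij ij1 ij2).1
  have c2 := (key i k j l hik hij hil hjk.symm hkl hjl
    (perm _ _ _ _ fun _ => by ac_rfl) yik ik1 ik2).1
  have c3 := (key i l j k hil hij hik hjl.symm hkl.symm hjk
    (perm _ _ _ _ fun _ => by ac_rfl) yil il1 il2).1
  have c4 := (key j k i l hjk hij.symm hjl hik.symm hkl hil
    (perm _ _ _ _ fun _ => by ac_rfl) yjk jk1 jk2).1
  have c5 := (key j l i k hjl hij.symm hjk hil.symm hkl.symm hik
    (perm _ _ _ _ fun _ => by ac_rfl) yjl jl1 jl2).1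
  have ncl1 := conf i j k l hij hik hil hjk hjl hkl hD yij yik ij1 ij2 ik1 ik2
  have ncl2 := conf j i k l hij.symm hjk hjl hik hil hkl
    (perm _ _ _ _ fun _ => by ac_rfl) yij yjk ij2 ij1 jk1 jk2
  have ncl3 := conf k i j l hik.symm hjk.symm hkl hij hil hjl
    (perm _ _ _ _ fun _ => by ac_rfl) yik yjk ik2 ik1 jk2 jk1
  have nck1 := conf i j l k hij hil hik hjl hjk hkl.symm
    (perm _ _ _ _ fun _ => by ac_rfl) yij yil ij1 ij2 il1 il2
  have nck2 := conf j i l k hij.symm hjl hjk hil hik hkl.symm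
    (perm _ _ _ _ fun _ => by ac_rfl) yij yjl ij2 ij1 jl1 jl2
  have nck3 := conf l i j k hil.symm hjl.symm hkl.symm hij hik hjk
    (perm _ _ _ _ fun _ => by ac_rfl) yil yjl il2 il1 jl2 jl1
  have ncj1 := conf i k l j hik hil hij hkl hjk.symm hjl.symm
    (perm _ _ _ _ fun _ => by ac_rfl) yik yil ik1 ik2 il1 il2
  have nci1 := conf j k l i hjk hjl hij.symm hkl hik.symm hil.symm
    (perm _ _ _ _ fun _ => by ac_rfl) yjk yjl jk1 jk2 jl1 jl2
  rcases c1 with c1 | c1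
  · have d3 := c3.resolve_right (nck1 c1)
    have d5 := c5.resolve_right (nck2 c1)
    have d2 := c2.resolve_left fun t => ncj1 t d3
    have d4 := c4.resolve_left fun t => nci1 t d5
    exact ncl3 d2 d4
  · have d2 := c2.resolve_right (ncl1 c1)
    have d4 := c4.resolve_right (ncl2 c1)
    have d3 := c3.resolve_left (ncj1 d2)
    have d5 := c5.resolve_left (nci1 d4)
    exact nck3 d3 d5

end IsDivisibleWeight
end Planar

/-! ### Exclusion of five simple directions -/

set_option maxRecDepth 100000 in
/-- Call a direction simple if it has a single empty line. The normalized moment equations of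
five simple directions have no solution over `ZMod 7`; the
fifth power stands for the inverse. -/
theorem no_five_moments_zmod : ∀ x y : ZMod 7, x ≠ 0 → y ≠ 0 → x ≠ 1 → y ≠ 1 → x ≠ y →
    ∀ a : ZMod 7, a ≠ 0 → ∀ b : ZMod 7, b ≠ 0 → ∀ c : ZMod 7, c ≠ 0 → -(a + b + c) ≠ 0 →
    b * (1 - 0) ^ 5 + c * (x - 0) ^ 5 + -(a + b + c) * (y - 0) ^ 5 = 1 →
    a * (0 - 1) ^ 5 + c * (x - 1) ^ 5 + -(a + b + c) * (y - 1) ^ 5 = 1 →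
    a * (0 - x) ^ 5 + b * (1 - x) ^ 5 + -(a + b + c) * (y - x) ^ 5 = 1 →
    a * (0 - y) ^ 5 + b * (1 - y) ^ 5 + c * (x - y) ^ 5 ≠ 1 := by
  decide

section

variable {K : Type*} [Field K] [Fintype K]

/-- The transfer of `no_five_moments_zmod` to `K`, with variables `z = 0` and `o = 1` for the two
normalized directions so that the equations keep the shape of differences. -/
theorem no_five_moments_normalized (hK : Fintype.card K = 7) {z o x y a b c d : K} (hz : z = 0)
    (ho : o = 1) (hx0 : x ≠ z) (hy0 : y ≠ z) (hx1 : x ≠ o) (hy1 : y ≠ o) (hxy : x ≠ y)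
    (ha : a ≠ 0) (hb : b ≠ 0) (hc : c ≠ 0) (hd : d ≠ 0) (h0 : a + b + c + d = 0)
    (h1 : b * (o - z)⁻¹ + c * (x - z)⁻¹ + d * (y - z)⁻¹ = 1)
    (h2 : a * (z - o)⁻¹ + c * (x - o)⁻¹ + d * (y - o)⁻¹ = 1)
    (h3 : a * (z - x)⁻¹ + b * (o - x)⁻¹ + d * (y - x)⁻¹ = 1)
    (h4 : a * (z - y)⁻¹ + b * (o - y)⁻¹ + c * (x - y)⁻¹ = 1) : False := by
  have hinv : ∀ t : K, t⁻¹ = t ^ 5 := by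
    intro t
    by_cases ht : t = 0
    · simp [ht]
    · have := FiniteField.pow_card_sub_one_eq_one t ht
      rw [hK] at this
      rw [inv_eq_of_mul_eq_one_right]
      rw [← this]
      ring
  let σ : K ≃+* ZMod 7 := (ZMod.ringEquivOfPrime K (by norm_num) hK).symm
  have hσ : ∀ {s t : K}, s ≠ t → σ s ≠ σ t := fun h => σ.injective.ne h
  have hd' : d = -(a + b + c) := by linear_combination h0
  subst hd' hz ho
  simp only [hinv] at h1 h2 h3 h4
  have e0 := map_zero σ
  have e1 := map_one σ
  refine no_five_moments_zmod (σ x) (σ y) (e0 ▸ hσ hx0) (e0 ▸ hσ hy0) (e1 ▸ hσ hx1) (e1 ▸ hσ hy1)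
    (hσ hxy) (σ a) (e0 ▸ hσ ha) (σ b) (e0 ▸ hσ hb) (σ c) (e0 ▸ hσ hc) ?_ ?_ ?_ ?_ ?_
  · have := hσ hd
    simpa only [map_add, map_neg, map_zero] using this
  · simpa only [map_add, map_sub, map_mul, map_neg, map_pow, e0, e1] using congrArg σ h1
  · simpa only [map_add, map_sub, map_mul, map_neg, map_pow, e0, e1] using congrArg σ h2
  · simpa only [map_add, map_sub, map_mul, map_neg, map_pow, e0, e1] using congrArg σ h3
  · simpa only [map_add, map_sub, map_mul, map_neg, map_pow, e0, e1] using congrArg σ h4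

/-- The moment equations satisfied by five simple directions, one of them `none` with moment `m`
and the others `p`, `q`, `r`, `s` with moments `a`, `b`, `c`, `d`, have no solution. -/
theorem no_five_moments (hK : Fintype.card K = 7) {p q r s a b c d m : K} (hpq : p ≠ q)
    (hpr : p ≠ r) (hps : p ≠ s) (hqr : q ≠ r) (hqs : q ≠ s) (hrs : r ≠ s)
    (ha : a ≠ 0) (hb : b ≠ 0) (hc : c ≠ 0) (hd : d ≠ 0) (hm : m ≠ 0)
    (h0 : a + b + c + d = 0)
    (h1 : m + (b * (q - p)⁻¹ + c * (r - p)⁻¹ + d * (s - p)⁻¹) = 0)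
    (h2 : m + (a * (p - q)⁻¹ + c * (r - q)⁻¹ + d * (s - q)⁻¹) = 0)
    (h3 : m + (a * (p - r)⁻¹ + b * (q - r)⁻¹ + d * (s - r)⁻¹) = 0)
    (h4 : m + (a * (p - s)⁻¹ + b * (q - s)⁻¹ + c * (r - s)⁻¹) = 0) : False := by
  have hδ : q - p ≠ 0 := sub_ne_zero.2 hpq.symm
  set δ := q - p with hδdef
  -- the affine substitution sending `p`, `q` to `0`, `1`, and the scaling making `m` equal to `-1`
  have hk : -(m * δ) ≠ 0 := neg_ne_zero.2 (mul_ne_zero hm hδ)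
  let f : K → K := fun t => (t - p) / δ
  have hf : ∀ t u : K, f t - f u = (t - u) / δ := fun t u => by simp only [f]; ring
  have hfne : ∀ {t u : K}, t ≠ u → f t ≠ f u := fun h => by
    rw [← sub_ne_zero, hf]
    exact div_ne_zero (sub_ne_zero.2 h) hδ
  have hfp : f p = 0 := by simp [f]
  have hfq : f q = 1 := by simp only [f]; exact div_self hδ
  have hterm : ∀ z t u : K, z / -(m * δ) * (f t - f u)⁻¹ = -m⁻¹ * (z * (t - u)⁻¹) := by
    intro z t u
    rw [hf, inv_div]
    by_cases htu : t - u = 0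
    · simp [htu]
    · field_simp
  have hone : ∀ z : K, m + z = 0 → -m⁻¹ * z = 1 := by
    intro z hz
    rw [eq_neg_of_add_eq_zero_right hz]
    field_simp
  refine no_five_moments_normalized hK hfp hfq (x := f r) (y := f s) (a := a / -(m * δ))
    (b := b / -(m * δ)) (c := c / -(m * δ)) (d := d / -(m * δ))
    (hfne hpr.symm) (hfne hps.symm) (hfne hqr.symm) (hfne hqs.symm)
    (hfne hrs) (div_ne_zero ha hk) (div_ne_zero hb hk) (div_ne_zero hc hk) (div_ne_zero hd hk)
    ?_ ?_ ?_ ?_ ?_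
  · rw [← add_div, ← add_div, ← add_div, h0, zero_div]
  all_goals
    rw [hterm, hterm, hterm, ← mul_add, ← mul_add]
    apply hone
    assumption

end

section Planar

variable {K : Type*} [Field K] [Fintype K] [DecidableEq K]

/-- The first moment of a distribution, with values in the field. -/
def moment (J : K → ℕ) : K := ∑ c, c * (J c : K)

omit [DecidableEq K] in
theorem sum_univ_eq_zero (hK : Fintype.card K = 7) : ∑ c : K, c = 0 := by
  simpa using FiniteField.sum_pow_lt_card_sub_one K 1 (by rw [hK]; norm_num)

omit [DecidableEq K] in
theorem moment_of_emptyCount_eq_zero (hK : Fintype.card K = 7) {J : K → ℕ} (hJ : ∑ c, J c = 7)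
    (h : emptyCount J = 0) : moment J = 0 := by
  simp only [moment, eq_one_of_emptyCount_eq_zero hK hJ h]
  simpa using sum_univ_eq_zero hK

theorem moment_ne_zero_of_emptyCount_eq_one (hK : Fintype.card K = 7) {J : K → ℕ}
    (hJ : ∑ c, J c = 7) (h : emptyCount J = 1) : moment J ≠ 0 := by
  obtain ⟨a, b, hab, hc⟩ := exists_of_emptyCount_eq_one hK hJ h
  have h1 : ∀ c, (J c : K) = 1 + ((if c = b then 1 else 0) - if c = a then 1 else 0) := by
    intro c
    have h2 := congrArg (Int.cast : ℤ → K) (hc c)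
    push_cast at h2
    rw [← h2]
    ring
  have h2 : moment J = b - a := by
    simp only [moment, h1, mul_add, mul_sub, Finset.sum_add_distrib, Finset.sum_sub_distrib]
    simp [sum_univ_eq_zero hK]
  rw [h2]
  exact sub_ne_zero.2 hab.symm

namespace IsDivisibleWeight

variable {n : K × K → ℕ} {J : Option K → K → ℕ}

theorem sum_cast_J_eq_zero (hK : Fintype.card K = 7) (h : IsDivisibleWeight n J) {δ : Option K}
    {y : K × K} (hJ : J δ (form δ y) = 0) :
    (J none y.1 : K) + ∑ β : K, (J (some β) (y.2 + β * y.1) : K) = 0 := by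
  have h1 := h.sum_J_form hK y
  rw [h.eq_zero_of_J_eq_zero hJ, Fintype.sum_option] at h1
  have h2 := congrArg (Nat.cast : ℕ → K) h1
  push_cast at h2
  rw [cast_seven hK] at h2
  exact h2

/-- The cancellation along an empty line of direction `none`, weighted by the position on the
line. -/
theorem sum_moment_eq_zero (hK : Fintype.card K = 7) (h : IsDivisibleWeight n J)
    (h0 : emptyCount (J none) ≠ 0) : ∑ β, moment (J (some β)) = 0 := by
  obtain ⟨a, ha⟩ := exists_eq_zero_of_emptyCount_ne_zero h0
  have h1 : ∑ b, b * ((J none a : K) + ∑ β : K, (J (some β) (b + β * a) : K)) = 0 :=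
    Finset.sum_eq_zero fun b _ => by
      rw [h.sum_cast_J_eq_zero hK (δ := none) (y := (a, b)) ha, mul_zero]
  rw [← h1]
  simp only [ha, Nat.cast_zero, zero_add, Finset.mul_sum]
  rw [Finset.sum_comm]
  refine Finset.sum_congr rfl fun β _ => ?_
  have h2 : moment (J (some β)) = ∑ c, (c - β * a) * (J (some β) c : K) := by
    simp only [sub_mul, Finset.sum_sub_distrib, ← Finset.mul_sum, ← Nat.cast_sum, h.sum_J]
    push_cast
    rw [cast_seven hK, mul_zero, sub_zero, moment]
  rw [h2, ← Equiv.sum_comp (Equiv.addRight (β * a))]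
  exact Finset.sum_congr rfl fun b _ => by simp

/-- The cancellation along an empty line of direction `some γ`, weighted by the position on the
line. The summand for `β = γ` vanishes since the inverse of zero is zero. -/
theorem moment_none_add_sum_eq_zero (hK : Fintype.card K = 7) (h : IsDivisibleWeight n J) {γ : K}
    (h0 : emptyCount (J (some γ)) ≠ 0) :
    moment (J none) + ∑ β, moment (J (some β)) * (β - γ)⁻¹ = 0 := by
  obtain ⟨c, hc⟩ := exists_eq_zero_of_emptyCount_ne_zero h0
  have h1 : ∑ a, a * ((J none a : K) + ∑ β : K, (J (some β) (c - γ * a + β * a) : K)) = 0 :=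
    Finset.sum_eq_zero fun a _ => by
      rw [h.sum_cast_J_eq_zero hK (δ := some γ) (y := (a, c - γ * a)), mul_zero]
      simpa [form_some] using hc
  rw [← h1]
  simp only [mul_add, Finset.sum_add_distrib, Finset.mul_sum]
  congr 1
  rw [Finset.sum_comm]
  refine Finset.sum_congr rfl fun β _ => ?_
  by_cases hβ : β - γ = 0
  · have : β = γ := sub_eq_zero.1 hβ
    subst this
    simp [hc]
  · have h2 : moment (J (some β)) = ∑ d, (d - c) * (J (some β) d : K) := by
      simp only [sub_mul, Finset.sum_sub_distrib, ← Finset.mul_sum, ← Nat.cast_sum, h.sum_J]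
      push_cast
      rw [cast_seven hK, mul_zero, sub_zero, moment]
    let φ : K ≃ K := (Equiv.mulLeft₀ (β - γ) hβ).trans (Equiv.addRight c)
    have hφ : ∀ a, φ a = (β - γ) * a + c := fun a => rfl
    rw [h2, ← Equiv.sum_comp φ, Finset.sum_mul]
    refine Finset.sum_congr rfl fun a _ => ?_
    rw [hφ, show c - γ * a + β * a = (β - γ) * a + c by ring]
    field_simp
    ring

/-- Five directions cannot all have a single empty line, as their moments would satisfy the
equations excluded by `no_five_moments`. -/
theorem not_five_simple (hK : Fintype.card K = 7) (h : IsDivisibleWeight n J)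
    (hnone : none ∈ nontrivialDirections J) (h5 : (nontrivialDirections J).card = 5) :
    ∃ δ ∈ nontrivialDirections J, emptyCount (J δ) ≠ 1 := by
  by_contra! hone
  let D : Finset K := Finset.univ.filter fun β => some β ∈ nontrivialDirections J
  have hD : nontrivialDirections J = insert none (D.map Function.Embedding.some) := by
    ext δ
    rcases δ with _ | β <;> simp [D, hnone]
  have hD4 : D.card = 4 := by
    rw [hD, Finset.card_insert_of_notMem (by simp), Finset.card_map] at h5
    omega
  obtain ⟨p, q, r, s, hpq, hpr, hps, hqr, hqs, hrs, hDe⟩ := Finset.card_eq_four.1 hD4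
  have hmem : ∀ β ∈ D, some β ∈ nontrivialDirections J := fun β hβ => (Finset.mem_filter.1 hβ).2
  have hsum : ∀ f : K → K, ∑ β, moment (J (some β)) * f β = moment (J (some p)) * f p
      + (moment (J (some q)) * f q + (moment (J (some r)) * f r + moment (J (some s)) * f s)) := by
    intro f
    rw [← Finset.sum_pair hrs (f := fun β => moment (J (some β)) * f β)]
    rw [← Finset.sum_insert (s := {r, s}) (a := q) (f := fun β => moment (J (some β)) * f β)
      (by simp [hqr, hqs])]
    rw [← Finset.sum_insert (s := {q, r, s}) (a := p) (f := fun β => moment (J (some β)) * f β)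
      (by simp [hpq, hpr, hps]), ← hDe]
    refine (Finset.sum_subset (Finset.subset_univ _) fun β _ hβ => ?_).symm
    have hβ' : some β ∉ nontrivialDirections J := fun hh =>
      hβ (Finset.mem_filter.2 ⟨Finset.mem_univ _, hh⟩)
    rw [mem_nontrivialDirections, not_not] at hβ'
    rw [moment_of_emptyCount_eq_zero hK (h.sum_J _) hβ', zero_mul]
  have hp : some p ∈ nontrivialDirections J := hmem p (by simp [hDe])
  have hq : some q ∈ nontrivialDirections J := hmem q (by simp [hDe])
  have hr : some r ∈ nontrivialDirections J := hmem r (by simp [hDe])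
  have hs : some s ∈ nontrivialDirections J := hmem s (by simp [hDe])
  have hne : ∀ δ ∈ nontrivialDirections J, moment (J δ) ≠ 0 := fun δ hδ =>
    moment_ne_zero_of_emptyCount_eq_one hK (h.sum_J _) (hone δ hδ)
  have h0 := h.sum_moment_eq_zero hK (mem_nontrivialDirections.1 hnone)
  have hz := hsum fun _ => 1
  simp only [mul_one] at hz
  rw [h0] at hz
  have e : ∀ γ, some γ ∈ nontrivialDirections J → _ := fun γ hγ =>
    h.moment_none_add_sum_eq_zero hK (mem_nontrivialDirections.1 hγ)
  simp only [hsum] at e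
  refine no_five_moments hK hpq hpr hps hqr hqs hrs (hne _ hp) (hne _ hq) (hne _ hr) (hne _ hs)
    (hne _ hnone) ?_ ?_ ?_ ?_ ?_
  · rw [hz]; ring
  · rw [← e p hp]; simp; ring
  · rw [← e q hq]; simp; ring
  · rw [← e r hr]; simp; ring
  · rw [← e s hs]; simp; ring

/-- Apart from the trivial case of one nontrivial direction, a weight that is not divisible by `7`
everywhere has three nontrivial directions with one empty line each, or four with `2, 1, 1, 1`
empty lines. -/
theorem nontrivialDirections_cases (hK : Fintype.card K = 7) (h : IsDivisibleWeight n J)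
    (hn : ∃ y, (n y : K) ≠ 0) (hnone : none ∈ nontrivialDirections J) :
    (nontrivialDirections J).card = 1 ∨
    ((nontrivialDirections J).card = 3 ∧ ∀ δ ∈ nontrivialDirections J, emptyCount (J δ) = 1) ∨
    ((nontrivialDirections J).card = 4 ∧ ∃ δ ∈ nontrivialDirections J, emptyCount (J δ) = 2 ∧
      ∀ ε ∈ nontrivialDirections J, ε ≠ δ → emptyCount (J ε) = 1) := by
  have h5 : ∑ δ ∈ nontrivialDirections J, emptyCount (J δ) ≤ 5 :=
    (Finset.sum_le_sum_of_subset (Finset.subset_univ _)).trans (sum_card_empty_le hK h hn)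
  have hpos : ∀ δ ∈ nontrivialDirections J, 1 ≤ emptyCount (J δ) := fun δ hδ =>
    Nat.one_le_iff_ne_zero.2 (mem_nontrivialDirections.1 hδ)
  -- the surplus of a direction over a single empty line
  have hsur : ∑ δ ∈ nontrivialDirections J, emptyCount (J δ)
      = ∑ δ ∈ nontrivialDirections J, (emptyCount (J δ) - 1) + (nontrivialDirections J).card := by
    rw [Finset.card_eq_sum_ones, ← Finset.sum_add_distrib]
    exact Finset.sum_congr rfl fun δ hδ => (Nat.sub_add_cancel (hpos δ hδ)).symm
  have hc1 : 1 ≤ (nontrivialDirections J).card := Finset.card_pos.2 ⟨_, hnone⟩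
  have hc5 : (nontrivialDirections J).card ≤ 5 := by omega
  have hc2 := h.card_nontrivialDirections_ne_two hK
  have hcases : (nontrivialDirections J).card = 1 ∨ (nontrivialDirections J).card = 3 ∨
    (nontrivialDirections J).card = 4 ∨ (nontrivialDirections J).card = 5 := by omega
  rcases hcases with hc | hc | hc | hc
  · exact Or.inl hc
  · exact Or.inr (Or.inl ⟨hc, h.emptyCount_eq_one_of_card_eq_three hK hn hc⟩)
  · refine Or.inr (Or.inr ⟨hc, ?_⟩)
    obtain ⟨δ, hδ, hδ1⟩ := h.not_four_simple hK hc
    have h6 := Finset.add_sum_erase (nontrivialDirections J) (fun δ => emptyCount (J δ) - 1) hδ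
    have h7 := hpos δ hδ
    refine ⟨δ, hδ, by omega, fun ε hε hne => ?_⟩
    have h8 := Finset.single_le_sum (f := fun δ => emptyCount (J δ) - 1) (fun _ _ => Nat.zero_le _)
      (Finset.mem_erase.2 ⟨hne, hε⟩)
    have h9 := hpos ε hε
    omega
  · exfalso
    obtain ⟨δ, hδ, hδ1⟩ := h.not_five_simple hK hnone hc
    have h8 := Finset.single_le_sum (f := fun δ => emptyCount (J δ) - 1) (fun _ _ => Nat.zero_le _)
      hδ
    have h7 := hpos δ hδ
    omega

end IsDivisibleWeight
end Planar

/-! ### Sums of deviations -/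

section Planar

variable {K : Type*} [Field K] [Fintype K] [DecidableEq K]

namespace IsDivisibleWeight

variable {n : K × K → ℕ} {J : Option K → K → ℕ}

theorem sum_deviation_le (hK : Fintype.card K = 7) (h : IsDivisibleWeight n J) :
    ∑ β, deviation (J (some β)) ≤ ∑ δ ∈ (nontrivialDirections J).erase none,
      ((emptyCount (J δ) : ℤ) + (emptyCount (J δ) : ℤ) ^ 2) := by
  have h1 : ∑ β, deviation (J (some β)) = ∑ δ ∈ Finset.univ.erase none, deviation (J δ) := by
    have h2 := Finset.add_sum_erase Finset.univ (fun δ => deviation (J δ)) (Finset.mem_univ none)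
    rw [Fintype.sum_option] at h2
    linarith
  rw [h1]
  refine (Finset.sum_le_sum fun δ _ => deviation_le hK (h.sum_J δ)).trans (le_of_eq ?_)
  refine (Finset.sum_subset (Finset.erase_subset_erase _ (Finset.subset_univ _))
    fun δ hδ hδ' => ?_).symm
  have : emptyCount (J δ) = 0 := by
    by_contra hne
    exact hδ' (Finset.mem_erase.2 ⟨(Finset.mem_erase.1 hδ).1, mem_nontrivialDirections.2 hne⟩)
  rw [this]
  norm_num

theorem sum_deviation_of_simple (hK : Fintype.card K = 7) (h : IsDivisibleWeight n J)
    (hn : ∃ y, (n y : K) ≠ 0) (h1 : emptyCount (J none) = 1) :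
    ∑ β, deviation (J (some β)) ≤ 4 ∨
      (∑ β, deviation (J (some β)) ≤ 10 ∧ ∃ β, emptyCount (J (some β)) = 2) := by
  have hmem : none ∈ nontrivialDirections J := mem_nontrivialDirections.2 (by omega)
  have hle := h.sum_deviation_le hK
  rcases h.nontrivialDirections_cases hK hn hmem with hc | ⟨hc, h3⟩ | ⟨hc, δ, hδ, hδ2, h4⟩
  · left
    have h0 : (nontrivialDirections J).erase none = ∅ := by
      rw [← Finset.card_eq_zero, Finset.card_erase_of_mem hmem, hc]
    rw [h0, Finset.sum_empty] at hle
    omega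
  · left
    refine hle.trans ?_
    rw [Finset.sum_congr rfl fun δ hδ => by rw [h3 δ (Finset.mem_of_mem_erase hδ)],
      Finset.sum_const, Finset.card_erase_of_mem hmem, hc]
    norm_num
  · right
    have hδn : δ ≠ none := by
      rintro rfl
      omega
    refine ⟨hle.trans ?_, ?_⟩
    · rw [← Finset.add_sum_erase _ _ (Finset.mem_erase.2 ⟨hδn, hδ⟩), hδ2,
        Finset.sum_congr rfl fun ε hε => by
          rw [h4 ε (Finset.mem_of_mem_erase (Finset.mem_of_mem_erase hε))
            (Finset.ne_of_mem_erase hε)],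
        Finset.sum_const, Finset.card_erase_of_mem (Finset.mem_erase.2 ⟨hδn, hδ⟩),
        Finset.card_erase_of_mem hmem, hc]
      norm_num
    · obtain ⟨β, rfl⟩ := Option.ne_none_iff_exists'.1 hδn
      exact ⟨β, hδ2⟩

theorem sum_deviation_of_not_simple (hK : Fintype.card K = 7) (h : IsDivisibleWeight n J)
    (hn : ∃ y, (n y : K) ≠ 0) (h2 : 2 ≤ emptyCount (J none)) :
    ∑ β, deviation (J (some β)) ≤ 0 ∨ ∃ β, emptyCount (J (some β)) = 1 := by
  have hmem : none ∈ nontrivialDirections J := mem_nontrivialDirections.2 (by omega)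
  have hle := h.sum_deviation_le hK
  rcases h.nontrivialDirections_cases hK hn hmem with hc | ⟨-, h3⟩ | ⟨hc, δ, hδ, hδ2, h4⟩
  · left
    have h0 : (nontrivialDirections J).erase none = ∅ := by
      rw [← Finset.card_eq_zero, Finset.card_erase_of_mem hmem, hc]
    rwa [h0, Finset.sum_empty] at hle
  · have := h3 _ hmem
    omega
  · right
    obtain ⟨ε, hε, hne⟩ := Finset.exists_mem_ne (by omega : 1 < (nontrivialDirections J).card) none
    have hδn : δ = none := by
      by_contra hne'
      have := h4 none hmem (Ne.symm hne')
      omega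
    obtain ⟨β, rfl⟩ := Option.ne_none_iff_exists'.1 hne
    exact ⟨β, h4 _ hε (hδn ▸ hne)⟩

theorem emptyCount_some_lt_two (hK : Fintype.card K = 7) (h : IsDivisibleWeight n J)
    (hn : ∃ y, (n y : K) ≠ 0) (h2 : 2 ≤ emptyCount (J none)) (β : K) :
    emptyCount (J (some β)) < 2 := by
  by_contra! hβ
  have hmem : none ∈ nontrivialDirections J := mem_nontrivialDirections.2 (by omega)
  have hmem' : some β ∈ nontrivialDirections J := mem_nontrivialDirections.2 (by omega)
  rcases h.nontrivialDirections_cases hK hn hmem with hc | ⟨-, h3⟩ | ⟨hc, δ, hδ, hδ2, h4⟩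
  · have := Finset.card_le_one.1 hc.le _ hmem _ hmem'
    cases this
  · have := h3 _ hmem
    omega
  · have h5 : none = δ := by
      by_contra hne
      have := h4 _ hmem hne
      omega
    have h6 : some β = δ := by
      by_contra hne
      have := h4 _ hmem' hne
      omega
    cases h5.trans h6.symm

end IsDivisibleWeight
end Planar

/-! ### Point sets in affine three-space -/

section Space

open Matrix

variable {K : Type*} [Field K] [Fintype K] [DecidableEq K]

/-- One seventh of the number of points of `S` on the plane `u ⬝ᵥ x = c`; the division is exact
for a set satisfying `IsPlaneDivisible`. -/
def planeCount (S : Finset (Fin 3 → K)) (u : Fin 3 → K) (c : K) : ℕ :=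
  (S.filter fun s => u ⬝ᵥ s = c).card / 7

/-- The number of points of `S` on the line on which `u` and `v` take the values `y.1` and
`y.2`. -/
def lineCount (S : Finset (Fin 3 → K)) (u v : Fin 3 → K) (y : K × K) : ℕ :=
  (S.filter fun s => (u ⬝ᵥ s, v ⬝ᵥ s) = y).card

/-- The functionals of the pencil spanned by `u` and `v`, up to scalars, indexed compatibly with
`form`. -/
def pencil (u v : Fin 3 → K) (δ : Option K) : Fin 3 → K :=
  match δ with
  | none => u
  | some β => v + β • u

omit [Fintype K] [DecidableEq K] in
theorem pencil_some (u v : Fin 3 → K) (β : K) : pencil u v (some β) = v + β • u := rfl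

/-- `S` consists of `49` points of affine three-space and every plane meets it in a multiple of
`7` points. -/
structure IsPlaneDivisible (S : Finset (Fin 3 → K)) : Prop where
  card_eq : S.card = 49
  dvd : ∀ u ≠ 0, ∀ c, 7 ∣ (S.filter fun s => u ⬝ᵥ s = c).card

namespace IsPlaneDivisible

variable {S : Finset (Fin 3 → K)}

omit [Fintype K] in
theorem card_filter (h : IsPlaneDivisible S) {u : Fin 3 → K} (hu : u ≠ 0) (c : K) :
    (S.filter fun s => u ⬝ᵥ s = c).card = 7 * planeCount S u c :=
  (Nat.mul_div_cancel' (h.dvd u hu c)).symm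

theorem sum_planeCount (h : IsPlaneDivisible S) {u : Fin 3 → K} (hu : u ≠ 0) :
    ∑ c, planeCount S u c = 7 := by
  have h1 := Finset.card_eq_sum_card_fiberwise (s := S) (t := Finset.univ) (f := fun s => u ⬝ᵥ s)
    (fun _ _ => Finset.mem_univ _)
  simp only [h.card_filter hu, ← Finset.mul_sum, h.card_eq] at h1
  omega

/-- The projection along the common kernel of two independent functionals turns `S` into a planar
weight. -/
theorem isDivisibleWeight (h : IsPlaneDivisible S) {u v : Fin 3 → K} (hu : u ≠ 0)
    (huv : ∀ c : K, c • u ≠ v) :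
    IsDivisibleWeight (lineCount S u v) fun δ => planeCount S (pencil u v δ) where
  sum_line δ c := by
    have hδ : pencil u v δ ≠ 0 := by
      rcases δ with _ | β
      · exact hu
      · intro h0
        apply huv (-β)
        rw [neg_smul, neg_eq_iff_add_eq_zero, add_comm]
        exact h0
    have hform : ∀ s, form δ (u ⬝ᵥ s, v ⬝ᵥ s) = pencil u v δ ⬝ᵥ s := by
      intro s
      rcases δ with _ | β
      · rfl
      · simp [form_some, pencil, add_dotProduct, smul_dotProduct]
    rw [← h.card_filter hδ]
    simp only [← hform]
    rw [Finset.card_eq_sum_card_fiberwise (f := fun s => (u ⬝ᵥ s, v ⬝ᵥ s))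
      (t := Finset.univ.filter fun y => form δ y = c)]
    · refine Finset.sum_congr rfl fun y hy => ?_
      rw [Finset.filter_filter, lineCount]
      congr 1
      ext s
      simp only [Finset.mem_filter, Finset.mem_univ, true_and] at hy ⊢
      constructor
      · rintro ⟨h1, h2⟩
        exact ⟨h1, by rw [h2, hy], h2⟩
      · rintro ⟨h1, -, h2⟩
        exact ⟨h1, h2⟩
    · intro s hs
      simpa using (Finset.mem_filter.1 hs).2
  sum_univ := by
    rw [← h.card_eq]
    exact (Finset.card_eq_sum_card_fiberwise (f := fun s => (u ⬝ᵥ s, v ⬝ᵥ s))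
      (fun _ _ => Finset.mem_univ _)).symm

end IsPlaneDivisible

omit [Fintype K] in
theorem planeCount_smul (S : Finset (Fin 3 → K)) (u : Fin 3 → K) {α : K} (hα : α ≠ 0) (c : K) :
    planeCount S (α • u) (α * c) = planeCount S u c := by
  simp only [planeCount, smul_dotProduct, smul_eq_mul, mul_right_inj' hα]

theorem deviation_planeCount_smul (S : Finset (Fin 3 → K)) (u : Fin 3 → K) {α : K} (hα : α ≠ 0) :
    deviation (planeCount S (α • u)) = deviation (planeCount S u) := by
  rw [deviation, ← Equiv.sum_comp (Equiv.mulLeft₀ α hα)]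
  refine Finset.sum_congr rfl fun c _ => ?_
  rw [show Equiv.mulLeft₀ α hα c = α * c from rfl, planeCount_smul S u hα]

omit [DecidableEq K] in
theorem card_ker_mul_card {W : Type*} [AddCommGroup W] [Module K W] [Finite W] (f : W →ₗ[K] K)
    (hf : f ≠ 0) : Nat.card {x // f x = 0} * Fintype.card K = Nat.card W := by
  have h1 := LinearMap.finrank_range_add_finrank_ker f
  rw [LinearMap.range_eq_top.2 (LinearMap.surjective hf), finrank_top, Module.finrank_self] at h1
  have h2 := Module.natCard_eq_pow_finrank (K := K) (V := W)
  have h3 := Module.natCard_eq_pow_finrank (K := K) (V := LinearMap.ker f)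
  rw [h2, ← h1, pow_add, pow_one, mul_comm, ← Nat.card_eq_fintype_card, ← h3]
  rfl

theorem card_dotProduct_eq_zero (hK : Fintype.card K = 7) {m : ℕ} {w : Fin (m + 1) → K}
    (hw : w ≠ 0) : (Finset.univ.filter fun u : Fin (m + 1) → K => u ⬝ᵥ w = 0).card = 7 ^ m := by
  let f : (Fin (m + 1) → K) →ₗ[K] K := (dotProductBilin K K).flip w
  have hf : f ≠ 0 := by
    intro h0
    apply hw
    rw [← dotProduct_eq_zero_iff]
    intro u
    rw [dotProduct_comm]
    exact LinearMap.congr_fun h0 u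
  have h1 := card_ker_mul_card f hf
  rw [Nat.card_eq_fintype_card, Nat.card_eq_fintype_card, hK, Fintype.card_fun, hK,
    Fintype.card_fin, Fintype.card_subtype] at h1
  change (Finset.univ.filter fun u : Fin (m + 1) → K => u ⬝ᵥ w = 0).card * 7 = 7 ^ (m + 1) at h1
  rw [pow_succ] at h1
  omega

namespace IsPlaneDivisible

variable {S : Finset (Fin 3 → K)}

/-- The second moment count, over pairs of points of `S` in a common plane. -/
theorem sum_deviation (hK : Fintype.card K = 7) (h : IsPlaneDivisible S) :
    ∑ u with u ≠ 0, deviation (planeCount S u) = 252 := by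
  -- the number of pairs of points of `S` in a common plane of a parallel class
  let T : (Fin 3 → K) → ℕ := fun u => ((S ×ˢ S).filter fun p => u ⬝ᵥ p.1 = u ⬝ᵥ p.2).card
  have hT : ∀ u ≠ 0, 49 * deviation (planeCount S u) = T u - 343 := by
    intro u hu
    have h1 : T u = ∑ c, (7 * planeCount S u c) * (7 * planeCount S u c) := by
      simp only [T]
      rw [Finset.card_eq_sum_card_fiberwise (t := Finset.univ) (f := fun p => u ⬝ᵥ p.1)
        (fun _ _ => Finset.mem_univ _)]
      refine Finset.sum_congr rfl fun c _ => ?_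
      rw [← h.card_filter hu, ← Finset.card_product]
      congr 1
      ext p
      simp only [Finset.mem_filter, Finset.mem_product]
      constructor
      · rintro ⟨⟨⟨h1, h2⟩, h3⟩, h4⟩
        exact ⟨⟨h1, h4⟩, h2, h3 ▸ h4⟩
      · rintro ⟨⟨h1, h4⟩, h2, h3⟩
        exact ⟨⟨⟨h1, h2⟩, h4.trans h3.symm⟩, h4⟩
    have h2 := h.sum_planeCount hu
    have h3 : (∑ c, (planeCount S u c : ℤ)) = 7 := by exact_mod_cast h2
    rw [h1]
    push_cast
    have h4 : ∑ c, 7 * (planeCount S u c : ℤ) * (7 * (planeCount S u c : ℤ))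
        = 49 * deviation (planeCount S u) + ∑ c, (98 * (planeCount S u c : ℤ) - 49) := by
      rw [deviation, Finset.mul_sum, ← Finset.sum_add_distrib]
      exact Finset.sum_congr rfl fun c _ => by ring
    rw [h4, Finset.sum_sub_distrib, ← Finset.mul_sum, h3]
    simp [hK]
  have hsum : ∑ u, T u = 132055 := by
    have h1 : ∑ u, T u = ∑ p ∈ S ×ˢ S, (Finset.univ.filter
        fun u : Fin 3 → K => u ⬝ᵥ p.1 = u ⬝ᵥ p.2).card := by
      simp only [T, Finset.card_filter]
      exact Finset.sum_comm
    have h2 : ∀ p ∈ S ×ˢ S, (Finset.univ.filter fun u : Fin 3 → K => u ⬝ᵥ p.1 = u ⬝ᵥ p.2).card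
        = 49 + if p.1 = p.2 then 294 else 0 := by
      intro p _
      split_ifs with hp
      · simp [hp, hK]
      · have : _ = 49 := card_dotProduct_eq_zero hK (sub_ne_zero.2 hp)
        rw [add_zero, ← this]
        simp only [dotProduct_sub, sub_eq_zero]
    rw [h1, Finset.sum_congr rfl h2, Finset.sum_add_distrib, Finset.sum_const, Finset.card_product,
      h.card_eq, Finset.sum_product]
    simp [h.card_eq]
  have hT0 : T 0 = 2401 := by simp [T, Finset.card_product, h.card_eq]
  have h1 := Finset.sum_filter_add_sum_filter_not Finset.univ (fun u : Fin 3 → K => u ≠ 0)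
    (fun u => (T u : ℤ))
  have h2 : (Finset.univ.filter fun u : Fin 3 → K => ¬u ≠ 0) = {0} := by
    ext
    simp
  rw [h2, Finset.sum_singleton, hT0, ← Nat.cast_sum Finset.univ T, hsum] at h1
  have h3 : 49 * ∑ u with u ≠ 0, deviation (planeCount S u)
      = ∑ u : Fin 3 → K with u ≠ 0, ((T u : ℤ) - 343) := by
    rw [Finset.mul_sum]
    exact Finset.sum_congr rfl fun u hu => hT u (Finset.mem_filter.1 hu).2
  have h4 : (Finset.univ.filter fun u : Fin 3 → K => u ≠ 0).card = 342 := by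
    rw [Finset.filter_ne', Finset.card_erase_of_mem (Finset.mem_univ _), Finset.card_univ,
      Fintype.card_fun, hK, Fintype.card_fin]
    norm_num
  rw [Finset.sum_sub_distrib, Finset.sum_const, h4, nsmul_eq_mul] at h3
  push_cast at h1 h3
  linarith

end IsPlaneDivisible

/-- The vectors outside the line spanned by `u`. -/
def offLine (u : Fin 3 → K) : Finset (Fin 3 → K) :=
  Finset.univ.filter fun v => ∀ c : K, c • u ≠ v

theorem mem_offLine {u v : Fin 3 → K} : v ∈ offLine u ↔ ∀ c : K, c • u ≠ v := by
  simp [offLine]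

theorem add_smul_mem_offLine {u v : Fin 3 → K} {β : K} : v + β • u ∈ offLine u ↔ v ∈ offLine u := by
  simp only [mem_offLine]
  constructor
  · intro h c hc
    exact h (c + β) (by rw [add_smul, hc])
  · intro h c hc
    exact h (c - β) (by rw [sub_smul, hc, add_sub_cancel_right])

theorem ne_zero_of_mem_offLine {u v : Fin 3 → K} (h : v ∈ offLine u) : v ≠ 0 := fun h0 =>
  mem_offLine.1 h 0 (by rw [zero_smul, h0])

theorem compl_offLine (u : Fin 3 → K) :
    (offLine u)ᶜ = Finset.univ.image fun c : K => c • u := by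
  ext v
  simp [mem_offLine]

theorem card_offLine (hK : Fintype.card K = 7) {u : Fin 3 → K} (hu : u ≠ 0) :
    (offLine u).card = 336 := by
  have h1 := Finset.card_add_card_compl (offLine u)
  rw [compl_offLine, Finset.card_image_of_injective _ (smul_left_injective K hu), Finset.card_univ,
    Fintype.card_fun, hK, Fintype.card_fin] at h1
  omega

/-- Averaging over all pencils through `u`. -/
theorem sum_offLine_pencil (hK : Fintype.card K = 7) (u : Fin 3 → K) (f : (Fin 3 → K) → ℤ) :
    ∑ v ∈ offLine u, ∑ β : K, f (v + β • u) = 7 * ∑ v ∈ offLine u, f v := by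
  rw [Finset.sum_comm]
  have h1 : ∀ β : K, ∑ v ∈ offLine u, f (v + β • u) = ∑ v ∈ offLine u, f v := by
    intro β
    refine Finset.sum_equiv (Equiv.addRight (β • u)) (fun v => ?_) fun v _ => rfl
    exact add_smul_mem_offLine.symm
  rw [Finset.sum_congr rfl fun β _ => h1 β]
  simp [hK]

/-- The global count. If `r u = 1`, the average of the pencil sums over the vectors off the line
of `u` is at least `5`, while a pencil sum exceeds `4` only if the pencil contains a vector with
`r = 2`; up to scalars there is only one such vector, which accounts for a single pencil. If `r`
never takes the value `1`, all pencil sums through some `u` vanish, which forces `e u = 42`,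
whereas `r u ≤ 5` gives `e u ≤ 30`. -/
theorem false_of_pencil_sums (hK : Fintype.card K = 7) (e : (Fin 3 → K) → ℤ)
    (r : (Fin 3 → K) → ℕ) (he0 : ∀ u, 0 ≤ e u) (her : ∀ u ≠ 0, e u ≤ r u + (r u : ℤ) ^ 2)
    (hr5 : ∀ u ≠ 0, r u ≤ 5) (hex : ∃ u, u ≠ 0 ∧ e u ≠ 0)
    (htot : ∀ u ≠ 0, ∑ v ∈ offLine u, ∑ β : K, e (v + β • u) = 7 * (252 - 6 * e u))
    (hA : ∀ u v, u ≠ 0 → v ∈ offLine u → r u = 1 →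
      ∑ β : K, e (v + β • u) ≤ 4 ∨ (∑ β : K, e (v + β • u) ≤ 10 ∧ ∃ β : K, r (v + β • u) = 2))
    (hB : ∀ u v, u ≠ 0 → v ∈ offLine u → 2 ≤ r u →
      ∑ β : K, e (v + β • u) ≤ 0 ∨ ∃ β : K, r (v + β • u) = 1)
    (hC : ∀ u v, u ≠ 0 → v ∈ offLine u → 2 ≤ r u → r v < 2) : False := by
  by_cases hone : ∃ u, u ≠ 0 ∧ r u = 1
  · obtain ⟨u, hu, hu1⟩ := hone
    have heu : e u ≤ 2 := by
      have := her u hu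
      rw [hu1] at this
      norm_num at this
      exact this
    have ht := htot u hu
    by_cases h4 : ∀ v ∈ offLine u, ∑ β : K, e (v + β • u) ≤ 4
    · have h5 := Finset.sum_le_card_nsmul _ _ _ h4
      rw [card_offLine hK hu] at h5
      norm_num at h5
      linarith
    · push Not at h4
      obtain ⟨v, hv, hv4⟩ := h4
      obtain ⟨-, β, hβ⟩ := (hA u v hu hv hu1).resolve_left (by omega)
      set z := v + β • u with hz
      have hzu : z ∈ offLine u := add_smul_mem_offLine.2 hv
      -- the vectors off the line of `u` in the plane spanned by `u` and `z`, where `r z = 2`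
      let P : Finset (Fin 3 → K) := ((Finset.univ.erase (0 : K)) ×ˢ (Finset.univ : Finset K)).image
        fun p => p.1 • z - p.2 • u
      have hP : P.card ≤ 42 := by
        refine Finset.card_image_le.trans ?_
        rw [Finset.card_product, Finset.card_erase_of_mem (Finset.mem_univ _), Finset.card_univ, hK]
      have hb : ∀ x ∈ offLine u, ∑ β : K, e (x + β • u) ≤ 4 + if x ∈ P then 6 else 0 := by
        intro x hx
        rcases hA u x hu hx hu1 with hx4 | ⟨hx10, γ, hγ⟩
        · split_ifs <;> omega
        · have hxP : x ∈ P := by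
            have hxγ : x + γ • u ∈ offLine u := add_smul_mem_offLine.2 hx
            have hlin : x + γ • u ∉ offLine z := by
              intro hmem
              have := hC z _ (ne_zero_of_mem_offLine hzu) hmem (by omega)
              omega
            rw [mem_offLine] at hlin
            push Not at hlin
            obtain ⟨c, hc⟩ := hlin
            refine Finset.mem_image.2 ⟨(c, γ), ?_, ?_⟩
            · simp only [Finset.mem_product, Finset.mem_erase, Finset.mem_univ, and_true]
              rintro rfl
              rw [zero_smul] at hc
              exact ne_zero_of_mem_offLine hxγ hc.symm
            · rw [hc, add_sub_cancel_right]
          rw [if_pos hxP]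
          omega
      have h5 := Finset.sum_le_sum hb
      rw [Finset.sum_add_distrib, Finset.sum_const, card_offLine hK hu, ← Finset.sum_filter,
        Finset.sum_const, ht] at h5
      have h6 : ((offLine u).filter fun x => x ∈ P).card ≤ 42 :=
        (Finset.card_le_card fun x hx => (Finset.mem_filter.1 hx).2).trans hP
      norm_num at h5
      have h7 : (((offLine u).filter fun x => x ∈ P).card : ℤ) ≤ 42 := by exact_mod_cast h6
      linarith
  · push Not at hone
    obtain ⟨u, hu, heu⟩ := hex
    have hru : 2 ≤ r u := by
      have h1 := hone u hu
      by_contra! h2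
      have h3 : r u = 0 := by omega
      have h4 := her u hu
      have h5 := he0 u
      rw [h3] at h4
      norm_num at h4
      omega
    have hzero : ∑ v ∈ offLine u, ∑ β : K, e (v + β • u) ≤ 0 := by
      refine Finset.sum_nonpos fun v hv => (hB u v hu hv hru).resolve_right ?_
      rintro ⟨β, hβ⟩
      exact hone _ (ne_zero_of_mem_offLine (add_smul_mem_offLine.2 hv)) hβ
    rw [htot u hu] at hzero
    have h7 := hr5 u hu
    have h8 := her u hu
    have h9 : (r u : ℤ) ≤ 5 := by exact_mod_cast h7
    nlinarith

namespace IsPlaneDivisible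

variable {S : Finset (Fin 3 → K)}

theorem sum_offLine_deviation (hK : Fintype.card K = 7) (h : IsPlaneDivisible S) {u : Fin 3 → K}
    (hu : u ≠ 0) :
    ∑ v ∈ offLine u, deviation (planeCount S v) = 252 - 6 * deviation (planeCount S u) := by
  have h1 : (Finset.univ.filter fun v : Fin 3 → K => v ≠ 0)
      = offLine u ∪ (Finset.univ.erase (0 : K)).image fun c => c • u := by
    ext v
    simp only [Finset.mem_filter, Finset.mem_univ, true_and, Finset.mem_union, Finset.mem_image,
      Finset.mem_erase, and_true]
    constructor
    · intro hv
      by_cases hvu : v ∈ offLine u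
      · exact Or.inl hvu
      · rw [mem_offLine] at hvu
        push Not at hvu
        obtain ⟨c, rfl⟩ := hvu
        exact Or.inr ⟨c, fun hc => hv (by rw [hc, zero_smul]), rfl⟩
    · rintro (hv | ⟨c, hc, rfl⟩)
      · exact ne_zero_of_mem_offLine hv
      · exact smul_ne_zero hc hu
  have h2 := h.sum_deviation hK
  rw [h1, Finset.sum_union, Finset.sum_image fun c _ d _ hcd => smul_left_injective K hu hcd,
    Finset.sum_congr rfl fun c hc => deviation_planeCount_smul S u (Finset.ne_of_mem_erase hc),
    Finset.sum_const, Finset.card_erase_of_mem (Finset.mem_univ _), Finset.card_univ, hK] at h2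
  · simp only [nsmul_eq_mul] at h2
    push_cast at h2
    linarith
  · rw [Finset.disjoint_left]
    intro v hv hv'
    obtain ⟨c, -, rfl⟩ := Finset.mem_image.1 hv'
    exact mem_offLine.1 hv c rfl

/-- Some projection of `S` along a direction has all its weights divisible by `7`. -/
theorem exists_forall_lineCount_eq_zero (hK : Fintype.card K = 7) (h : IsPlaneDivisible S) :
    ∃ u v : Fin 3 → K, u ≠ 0 ∧ v ∈ offLine u ∧ ∀ y, (lineCount S u v y : K) = 0 := by
  by_contra! hno
  have hw := fun (u v : Fin 3 → K) (hu : u ≠ 0) (hv : v ∈ offLine u) =>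
    h.isDivisibleWeight hu (mem_offLine.1 hv)
  refine false_of_pencil_sums hK (fun u => deviation (planeCount S u))
    (fun u => emptyCount (planeCount S u)) (fun u => Finset.sum_nonneg fun _ _ => sq_nonneg _)
    (fun u hu => deviation_le hK (h.sum_planeCount hu)) (fun u hu => ?_) ?_ (fun u hu => ?_)
    (fun u v hu hv h1 => ?_) (fun u v hu hv h2 => ?_) (fun u v hu hv h2 => ?_)
  · obtain ⟨v, hv⟩ : (offLine u).Nonempty := by
      rw [← Finset.card_pos, card_offLine hK hu]
      norm_num
    have h5 := sum_card_empty_le hK (hw u v hu hv) (hno u v hu hv)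
    have h6 := Finset.single_le_sum (f := fun δ => (Finset.univ.filter
      fun c => planeCount S (pencil u v δ) c = 0).card) (fun _ _ => Nat.zero_le _)
      (Finset.mem_univ none)
    exact h6.trans h5
  · by_contra! h0
    have h1 := h.sum_deviation hK
    rw [Finset.sum_eq_zero fun u hu => h0 u (Finset.mem_filter.1 hu).2] at h1
    norm_num at h1
  · rw [sum_offLine_pencil hK u fun u => deviation (planeCount S u),
      h.sum_offLine_deviation hK hu]
  · have := (hw u v hu hv).sum_deviation_of_simple hK (hno u v hu hv) h1
    simpa only [pencil_some] using this
  · have := (hw u v hu hv).sum_deviation_of_not_simple hK (hno u v hu hv) h2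
    simpa only [pencil_some] using this
  · have := (hw u v hu hv).emptyCount_some_lt_two hK (hno u v hu hv) h2 0
    simpa only [pencil_some, zero_smul, add_zero] using this

/-- `S` is the union of seven distinct parallel lines: a line of the direction found by
`exists_forall_lineCount_eq_zero` has only seven points, so it meets `S` in no point or is
contained in `S`. -/
theorem exists_parallel_lines (hK : Fintype.card K = 7) (h : IsPlaneDivisible S) :
    ∃ (d : Fin 3 → K) (x : Fin 7 → Fin 3 → K), d ≠ 0 ∧
      (∀ s, s ∈ S ↔ ∃ i, ∃ t : K, s = x i + t • d) ∧
      ∀ i j (t : K), x i = x j + t • d → i = j := by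
  obtain ⟨u, v, hu, hv, hn⟩ := h.exists_forall_lineCount_eq_zero hK
  -- the direction of the lines on which both functionals are constant
  obtain ⟨d, hd0, hd⟩ : ∃ d : Fin 3 → K, d ≠ 0 ∧ ∀ x, (u ⬝ᵥ x = 0 ∧ v ⬝ᵥ x = 0) ↔
      ∃ t : K, x = t • d := by
    let A : Matrix (Fin 2) (Fin 3) K := ![u, v]
    have hA : A.rank = 2 := by
      have : LinearIndependent K ![u, v] := (LinearIndependent.pair_iff' hu).2 (mem_offLine.1 hv)
      simpa using LinearIndependent.rank_matrix (M := A) this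
    have hker : ∀ x, x ∈ LinearMap.ker A.mulVecLin ↔ u ⬝ᵥ x = 0 ∧ v ⬝ᵥ x = 0 := by
      intro x
      rw [LinearMap.mem_ker, mulVecLin_apply, funext_iff, Fin.forall_fin_two]
      rfl
    have h1 := LinearMap.finrank_range_add_finrank_ker A.mulVecLin
    rw [show Module.finrank K (LinearMap.range A.mulVecLin) = 2 from hA] at h1
    simp only [Module.finrank_fintype_fun_eq_card, Fintype.card_fin] at h1
    obtain ⟨d, hd0, hd⟩ := finrank_eq_one_iff'.1
      (show Module.finrank K (LinearMap.ker A.mulVecLin) = 1 by omega)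
    refine ⟨d, fun h0 => hd0 (Subtype.ext h0), fun x => ?_⟩
    rw [← hker]
    constructor
    · intro hx
      obtain ⟨c, hc⟩ := hd ⟨x, hx⟩
      exact ⟨c, (congrArg Subtype.val hc).symm⟩
    · rintro ⟨t, rfl⟩
      exact Submodule.smul_mem _ _ d.2
  let π : (Fin 3 → K) → K × K := fun s => (u ⬝ᵥ s, v ⬝ᵥ s)
  have hπ : ∀ s s', π s = π s' ↔ ∃ t : K, s = s' + t • d := by
    intro s s'
    have := hd (s - s')
    simp only [dotProduct_sub, sub_eq_iff_eq_add'] at this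
    rw [← this]
    simp [π]
  have hfull : ∀ s ∈ S, (S.filter fun s' => π s' = π s) =
      Finset.univ.image fun t : K => s + t • d := by
    intro s hs
    refine Finset.eq_of_subset_of_card_le (fun s' hs' => ?_) ?_
    · obtain ⟨t, ht⟩ := (hπ s' s).1 (Finset.mem_filter.1 hs').2
      exact Finset.mem_image.2 ⟨t, Finset.mem_univ _, ht.symm⟩
    · refine Finset.card_image_le.trans ?_
      rw [Finset.card_univ, hK]
      have h1 := hn (π s)
      have : Fact (Nat.Prime 7) := ⟨by norm_num⟩
      have : CharP K 7 := charP_of_card_eq_prime hK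
      rw [CharP.cast_eq_zero_iff K 7] at h1
      exact Nat.le_of_dvd (Finset.card_pos.2 ⟨s, Finset.mem_filter.2 ⟨hs, rfl⟩⟩) h1
  have hT : (S.image π).card = 7 := by
    have h1 := Finset.card_eq_sum_card_image π S
    rw [h.card_eq, Finset.sum_congr rfl (g := fun _ => 7), Finset.sum_const, smul_eq_mul] at h1
    · omega
    · intro y hy
      obtain ⟨s, hs, rfl⟩ := Finset.mem_image.1 hy
      rw [hfull s hs, Finset.card_image_of_injective, Finset.card_univ, hK]
      intro t t' htt
      exact smul_left_injective K hd0 (add_left_cancel htt)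
  let φ := (Finset.equivFinOfCardEq hT).symm
  have hx : ∀ i, ∃ s ∈ S, π s = φ i := fun i => Finset.mem_image.1 (φ i).2
  choose x hxS hxπ using hx
  refine ⟨d, x, hd0, fun s => ⟨fun hs => ?_, ?_⟩, fun i j t hij => ?_⟩
  · obtain ⟨i, hi⟩ := φ.surjective ⟨π s, Finset.mem_image_of_mem π hs⟩
    exact ⟨i, (hπ _ _).1 (by rw [hxπ, hi])⟩
  · rintro ⟨i, t, rfl⟩
    have h1 : x i + t • d ∈ S.filter fun s' => π s' = π (x i) := by
      rw [hfull _ (hxS i)]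
      exact Finset.mem_image_of_mem _ (Finset.mem_univ t)
    exact (Finset.mem_filter.1 h1).1
  · apply φ.injective
    apply Subtype.ext
    rw [← hxπ, ← hxπ]
    exact (hπ _ _).2 ⟨t, hij⟩

end IsPlaneDivisible

end Space

/-! ### From affine three-space to the two conjectures -/

open Matrix

theorem originalCylinderConjecture_seven : OriginalCylinderConjecture 7 := by
  classical
  have : Fact (Nat.Prime 7) := ⟨by norm_num⟩
  intro S hS hdiv
  have hK : Fintype.card (ZMod 7) = 7 := ZMod.card 7
  have h : IsPlaneDivisible S.toFinset := by
    refine ⟨by rw [← Set.ncard_eq_toFinset_card']; exact hS, fun u hu c => ?_⟩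
    let f : (Fin 3 → ZMod 7) →ₗ[ZMod 7] ZMod 7 := dotProductBilin (ZMod 7) (ZMod 7) u
    have hf : f ≠ 0 := fun h0 => hu (dotProduct_eq_zero_iff.1 fun v => LinearMap.congr_fun h0 v)
    obtain ⟨x₀, hx₀⟩ := LinearMap.surjective hf c
    have hker : Module.finrank (ZMod 7) (LinearMap.ker f) = 2 := by
      have h1 := LinearMap.finrank_range_add_finrank_ker f
      rw [LinearMap.range_eq_top.2 (LinearMap.surjective hf), finrank_top,
        Module.finrank_self] at h1
      simp only [Module.finrank_fintype_fun_eq_card, Fintype.card_fin] at h1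
      omega
    have h2 := hdiv (AffineSubspace.mk' x₀ (LinearMap.ker f)) (by
      rw [AffineSubspace.direction_mk']; exact hker)
    rw [Nat.modEq_zero_iff_dvd] at h2
    have h3 : S ∩ (AffineSubspace.mk' x₀ (LinearMap.ker f) : Set (Fin 3 → ZMod 7))
        = ((S.toFinset.filter fun s => u ⬝ᵥ s = c : Finset _) : Set (Fin 3 → ZMod 7)) := by
      ext s
      simp only [Set.mem_inter_iff, SetLike.mem_coe, AffineSubspace.mem_mk', LinearMap.mem_ker,
        vsub_eq_sub, map_sub, hx₀, sub_eq_zero, Finset.coe_filter, Set.mem_toFinset,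
        Set.mem_ofPred_eq]
      rfl
    rwa [h3, Set.ncard_coe_finset] at h2
  obtain ⟨d, x, hd, hmem, hinj⟩ := h.exists_parallel_lines hK
  refine ⟨fun i => AffineSubspace.mk' (x i) (Submodule.span (ZMod 7) {d}), ?_, ?_, ?_, ?_⟩
  · intro i j hij
    have h1 : x i ∈ AffineSubspace.mk' (x j) (Submodule.span (ZMod 7) {d}) := by
      dsimp only at hij
      rw [← hij]
      exact AffineSubspace.self_mem_mk' _ _
    rw [AffineSubspace.mem_mk', vsub_eq_sub, Submodule.mem_span_singleton] at h1
    obtain ⟨t, ht⟩ := h1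
    exact hinj i j t (by rw [ht, add_sub_cancel])
  · intro i
    rw [AffineSubspace.direction_mk', finrank_span_singleton hd]
  · intro i j
    rw [AffineSubspace.parallel_iff_direction_eq_and_eq_bot_iff_eq_bot]
    simp only [AffineSubspace.direction_mk', true_and]
    constructor <;> intro h0
    · exact absurd (h0 ▸ AffineSubspace.self_mem_mk' (x i) _) (AffineSubspace.notMem_bot _ _ _)
    · exact absurd (h0 ▸ AffineSubspace.self_mem_mk' (x j) _) (AffineSubspace.notMem_bot _ _ _)
  · ext s
    rw [← Set.mem_toFinset, hmem, Set.mem_iUnion]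
    refine exists_congr fun i => ?_
    rw [SetLike.mem_coe, AffineSubspace.mem_mk', vsub_eq_sub, Submodule.mem_span_singleton]
    exact exists_congr fun t => ⟨fun hs => by rw [hs, add_sub_cancel_left],
      fun hs => by rw [hs, add_sub_cancel]⟩

section Projective

variable {K : Type u} {V : Type w} [Field K] [AddCommGroup V] [Module K V]

theorem submodule_le_iff {P : Projectivization K V} {H : Submodule K V} :
    P.submodule ≤ H ↔ P.rep ∈ H := by
  rw [Projectivization.submodule_eq, Submodule.span_singleton_le_iff_mem]

theorem eq_of_rep_eq_smul {P Q : Projectivization K V} {a : K} (h : P.rep = a • Q.rep) : P = Q := by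
  rw [← P.mk_rep, ← Q.mk_rep, Projectivization.mk_eq_mk_iff']
  exact ⟨a, h.symm⟩

open Classical in
theorem IsDivisible.dvd_card_filter [FiniteDimensional K V] {Δ : ℕ}
    {S : Finset (Projectivization K V)}
    (h : IsDivisible Δ S.val) (hS : Δ ∣ S.card) {f : V →ₗ[K] K} (hf : f ≠ 0) :
    Δ ∣ (S.filter fun P => f P.rep = 0).card := by
  have h1 := LinearMap.finrank_range_add_finrank_ker f
  rw [LinearMap.range_eq_top.2 (LinearMap.surjective hf), finrank_top, Module.finrank_self] at h1
  have h2 := h (LinearMap.ker f) (by omega)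
  rw [← Nat.modEq_zero_iff_dvd] at hS ⊢
  simp only [submodule_le_iff, LinearMap.mem_ker] at h2
  exact h2.trans hS

open Classical in
/-- The average number of points of `S` on a hyperplane is less than `7`, so some hyperplane
misses `S`. -/
theorem exists_empty_hyperplane [Fintype K] [Finite V] (hK : Fintype.card K = 7)
    (hV : Module.finrank K V = 4) {S : Finset (Projectivization K V)} (hS : S.card = 49)
    (h : IsDivisible 7 S.val) : ∃ f : V →ₗ[K] K, f ≠ 0 ∧ ∀ P ∈ S, f P.rep ≠ 0 := by
  let e : V ≃ₗ[K] (Fin 4 → K) := LinearEquiv.ofFinrankEq _ _ (by simp [hV])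
  let F : (Fin 4 → K) → V →ₗ[K] K := fun w => dotProductBilin K K w ∘ₗ e.toLinearMap
  have hF : ∀ w v, F w v = w ⬝ᵥ e v := fun _ _ => rfl
  have hF0 : ∀ w ≠ 0, F w ≠ 0 := fun w hw h0 => hw (dotProduct_eq_zero_iff.1 fun v => by
    have := LinearMap.congr_fun h0 (e.symm v)
    rwa [hF, e.apply_symm_apply] at this)
  by_contra! hcon
  have hge : ∀ w ∈ (Finset.univ.erase (0 : Fin 4 → K)),
      7 ≤ (S.filter fun P => F w P.rep = 0).card := by
    intro w hw
    obtain ⟨P, hP, hP0⟩ := hcon (F w) (hF0 w (Finset.ne_of_mem_erase hw))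
    exact Nat.le_of_dvd (Finset.card_pos.2 ⟨P, Finset.mem_filter.2 ⟨hP, hP0⟩⟩)
      (h.dvd_card_filter (by rw [hS]; norm_num) (hF0 w (Finset.ne_of_mem_erase hw)))
  have h1 := Finset.card_nsmul_le_sum _ _ _ hge
  have h2 : ∑ w, (S.filter fun P => F w P.rep = 0).card = 49 * 343 := by
    simp only [Finset.card_filter]
    rw [Finset.sum_comm, ← hS, ← smul_eq_mul, ← Finset.sum_const]
    refine Finset.sum_congr rfl fun P _ => ?_
    rw [← Finset.card_filter]
    have he : e P.rep ≠ 0 := by simpa using P.rep_nonzero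
    have h4 : _ = 343 := card_dotProduct_eq_zero hK he
    simpa only [hF] using h4
  rw [← Finset.add_sum_erase _ _ (Finset.mem_univ (0 : Fin 4 → K))] at h2
  have h3 : (S.filter fun P => F 0 P.rep = 0).card = 49 := by
    simp [hF, hS]
  rw [h3] at h2
  rw [Finset.card_erase_of_mem (Finset.mem_univ _), Finset.card_univ, Fintype.card_fun, hK,
    Fintype.card_fin, smul_eq_mul] at h1
  norm_num at h1 h2
  omega

end Projective

theorem generalizedCylinderConjecture_four_one_seven :
    GeneralizedCylinderConjecture.{u, w} 4 1 7 := by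
  classical
  intro K V _ _ _ _ hq hV S hS _ hdiv
  have hS : S.card = 49 := hS
  have hdiv : IsDivisible 7 S.val := hdiv
  have : Finite K := Nat.finite_of_card_ne_zero (by omega)
  let _ : Fintype K := Fintype.ofFinite K
  have hK : Fintype.card K = 7 := by rw [← Nat.card_eq_fintype_card, hq]
  obtain ⟨φ, hφ, hSφ⟩ := exists_empty_hyperplane hK hV hS hdiv
  obtain ⟨v₀, hv₀⟩ := LinearMap.surjective hφ 1
  -- the affine chart `x ↦ v₀ + j x` of the complement of the hyperplane `φ = 0`
  have hker : Module.finrank K (LinearMap.ker φ) = 3 := by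
    have h1 := LinearMap.finrank_range_add_finrank_ker φ
    rw [LinearMap.range_eq_top.2 (LinearMap.surjective hφ), finrank_top, Module.finrank_self] at h1
    omega
  let ψ : (Fin 3 → K) ≃ₗ[K] LinearMap.ker φ := LinearEquiv.ofFinrankEq _ _ (by simp [hker])
  let j : (Fin 3 → K) →ₗ[K] V := (LinearMap.ker φ).subtype ∘ₗ ψ.toLinearMap
  have hj : Function.Injective j := (Submodule.subtype_injective _).comp ψ.injective
  have hφj : ∀ x, φ (j x) = 0 := fun x => (ψ x).2
  have hφv : ∀ (a : K) x, φ (a • (v₀ + j x)) = a := fun a x => by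
    rw [map_smul, map_add, hv₀, hφj, add_zero, smul_eq_mul, mul_one]
  have hjsurj : ∀ v, φ v = 1 → ∃ x, v = v₀ + j x := by
    intro v hv
    have hm : v - v₀ ∈ LinearMap.ker φ := by rw [LinearMap.mem_ker, map_sub, hv, hv₀, sub_self]
    refine ⟨ψ.symm ⟨v - v₀, hm⟩, ?_⟩
    have : j (ψ.symm ⟨v - v₀, hm⟩) = v - v₀ := by simp [j]
    rw [this, add_sub_cancel]
  have hx : ∀ P : Projectivization K V, ∃ x, P ∈ S → P.rep = φ P.rep • (v₀ + j x) := by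
    intro P
    by_cases hP : P ∈ S
    · have h0 := hSφ P hP
      obtain ⟨x, hx⟩ := hjsurj ((φ P.rep)⁻¹ • P.rep) (by
        rw [map_smul, smul_eq_mul, inv_mul_cancel₀ h0])
      exact ⟨x, fun _ => by rw [← hx, smul_inv_smul₀ h0]⟩
    · exact ⟨0, fun h => absurd h hP⟩
  choose x hx using hx
  have hxinj : Set.InjOn x S := by
    intro P hP Q hQ hPQ
    refine eq_of_rep_eq_smul (a := φ P.rep * (φ Q.rep)⁻¹) ?_
    rw [hx P hP, hx Q hQ, hPQ]
    simp only [map_smul, map_add, hv₀, hφj, smul_smul, smul_eq_mul]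
    congr 1
    have := hSφ Q hQ
    field_simp
  obtain ⟨g, hg⟩ := LinearMap.exists_leftInverse_of_injective j (LinearMap.ker_eq_bot.2 hj)
  have hgj : ∀ y, g (j y) = y := fun y => LinearMap.congr_fun hg y
  have hT : IsPlaneDivisible (S.image x) := by
    refine ⟨by rw [Finset.card_image_of_injOn hxinj, hS], fun u hu c => ?_⟩
    let F : V →ₗ[K] K := dotProductBilin K K u ∘ₗ g - (c + u ⬝ᵥ g v₀) • φ
    have hF : ∀ y, F (v₀ + j y) = u ⬝ᵥ y - c := by
      intro y
      have : F (v₀ + j y) = u ⬝ᵥ g (v₀ + j y) - (c + u ⬝ᵥ g v₀) * φ (v₀ + j y) := rfl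
      rw [this, map_add, map_add, hgj, hφj, hv₀, dotProduct_add]
      ring
    have hF0 : F ≠ 0 := by
      intro h0
      apply hu
      rw [← dotProduct_eq_zero_iff]
      intro y
      have h1 := hF y
      have h2 := hF 0
      rw [h0, LinearMap.zero_apply] at h1 h2
      rw [dotProduct_zero] at h2
      linear_combination h2 - h1
    have h1 := hdiv.dvd_card_filter (by rw [hS]; norm_num) hF0
    rw [Finset.filter_image, Finset.card_image_of_injOn
      (hxinj.mono fun P hP => (Finset.mem_filter.1 hP).1)]
    have h2 : (S.filter fun P => u ⬝ᵥ x P = c) = S.filter fun P => F P.rep = 0 := by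
      refine Finset.filter_congr fun P hP => ?_
      rw [hx P hP, map_smul, hF, smul_eq_zero, or_iff_right (hSφ P hP), sub_eq_zero]
    rwa [h2]
  obtain ⟨d, z, hd, hmem, hinj⟩ := hT.exists_parallel_lines hK
  have hjd : j d ≠ 0 := fun h0 => hd (hj (h0.trans (map_zero j).symm))
  let z' : Fin (Nat.card K) → (Fin 3 → K) := fun i => z (Fin.cast hq i)
  let A : Submodule K V := Submodule.span K {j d}
  let L : Fin (Nat.card K) → Submodule K V := fun i => Submodule.span K {v₀ + j (z' i), j d}
  have hφA : ∀ v ∈ A, φ v = 0 := by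
    intro v hv
    obtain ⟨t, rfl⟩ := Submodule.mem_span_singleton.1 hv
    rw [map_smul, hφj, smul_zero]
  -- the points of the affine line with direction `d` through `z' i`
  have hdiff : ∀ i P, P ∈ pointsDiff (L i) A ↔
      ∃ a t : K, a ≠ 0 ∧ P.rep = a • (v₀ + j (z' i + t • d)) := by
    intro i P
    rw [pointsDiff, Set.Finite.mem_toFinset, Set.mem_ofPred_eq, submodule_le_iff, submodule_le_iff,
      Submodule.mem_span_pair]
    constructor
    · rintro ⟨⟨a, b, hab⟩, hnot⟩
      have ha : a ≠ 0 := by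
        rintro rfl
        rw [zero_smul, zero_add] at hab
        exact hnot (Submodule.mem_span_singleton.2 ⟨b, hab⟩)
      refine ⟨a, a⁻¹ * b, ha, ?_⟩
      rw [← hab, map_add, map_smul, ← add_assoc, smul_add _ _ (_ • _), smul_smul,
        mul_inv_cancel_left₀ ha]
    · rintro ⟨a, t, ha, hP⟩
      refine ⟨⟨a, a * t, ?_⟩, fun hPA => ?_⟩
      · rw [hP, map_add, map_smul, ← add_assoc, smul_add _ _ (_ • _), smul_smul]
      · have := hφA _ hPA
        rw [hP, hφv] at this
        exact ha this
  refine ⟨A, L, finrank_span_singleton hjd, fun i => ⟨?_, ?_⟩, ?_⟩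
  · have hli : LinearIndependent K ![j d, v₀ + j (z' i)] := by
      rw [LinearIndependent.pair_iff' hjd]
      intro a ha
      have := congrArg φ ha
      rw [map_smul, hφj, map_add, hv₀, hφj, smul_zero, add_zero] at this
      exact zero_ne_one this
    have h1 := finrank_span_eq_card hli
    rw [Matrix.range_cons, Matrix.range_cons, Matrix.range_empty, Set.union_empty,
      Set.union_comm, Fintype.card_fin] at h1
    exact h1
  · exact Submodule.span_mono (by simp)
  · refine Multiset.ext' fun P => ?_
    rw [Multiset.count_sum']
    simp only [Multiset.count_eq_of_nodup (Finset.nodup _), Finset.mem_val]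
    by_cases hP : P ∈ S
    · rw [if_pos hP]
      obtain ⟨i, t, hi⟩ := (hmem (x P)).1 (Finset.mem_image_of_mem x hP)
      have hi' : z' (Fin.cast hq.symm i) = z i := rfl
      have hPi : P ∈ pointsDiff (L (Fin.cast hq.symm i)) A :=
        (hdiff _ P).2 ⟨φ P.rep, t, hSφ P hP, by rw [hi', ← hi]; exact hx P hP⟩
      rw [Finset.sum_eq_single (Fin.cast hq.symm i), if_pos hPi]
      · intro k _ hk
        rw [if_neg]
        intro hPk
        obtain ⟨a, t, ha, hPa⟩ := (hdiff k P).1 hPk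
        obtain ⟨b, s, hb, hPb⟩ := (hdiff _ P).1 hPi
        have hab : a = b := by
          rw [← hφv a (z' k + t • d), ← hPa, hPb, hφv]
        subst hab
        have h1 := hj (add_left_cancel (smul_right_injective V ha (hPa.symm.trans hPb)))
        have h2 := hinj (Fin.cast hq k) i (s - t) (by
          rw [sub_smul, ← add_sub_assoc, eq_sub_iff_add_eq]
          exact h1)
        exact hk (by rw [← h2]; rfl)
      · exact fun h => absurd (Finset.mem_univ _) h
    · rw [if_neg hP, Finset.sum_eq_zero]
      intro i _
      rw [if_neg]
      intro hPi
      obtain ⟨a, t, ha, hPa⟩ := (hdiff i P).1 hPi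
      obtain ⟨Q, hQ, hQx⟩ := Finset.mem_image.1 ((hmem _).2 ⟨Fin.cast hq i, t, rfl⟩)
      have hPQ : P = Q := by
        refine eq_of_rep_eq_smul (a := a * (φ Q.rep)⁻¹) ?_
        have h1 := hx Q hQ
        rw [hQx] at h1
        have h2 : (φ Q.rep)⁻¹ • Q.rep = v₀ + j (z (Fin.cast hq i) + t • d) :=
          (inv_smul_eq_iff₀ (hSφ Q hQ)).2 h1
        rw [mul_smul, h2]
        exact hPa
      exact hP (hPQ ▸ hQ)

end CylinderConjecture

theorem mainTheorem2 :
    CylinderConjecture.GeneralizedCylinderConjecture.{u, w} 4 1 7 ∧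
      CylinderConjecture.OriginalCylinderConjecture 7 :=
  ⟨CylinderConjecture.generalizedCylinderConjecture_four_one_seven,
    CylinderConjecture.originalCylinderConjecture_seven⟩
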